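/- Let $\mathbb{D}$ be the open unit disc, $\mathcal{H}(\mathbb{D})$ the space of analytic functions on $\mathbb{D}$, $0<p<\infty$ and $\alpha\ge -1$. For $\alpha>-1$ let $A^p_\alpha$ be the weighted Bergman space of all $f\in\mathcal{H}(\mathbb{D})$ with $$\|f\|_{\alpha,p}^p:=(\alpha+1)\int_{\mathbb{D}}|f(z)|^p(1-|z|^2)^\alpha\,dA(z)<\infty ,$$ where $dA$ is the normalized area measure on $\mathbb{D}$, and let $A^p_{-1}:=H^p$ be the Hardy space, with $\|f\|_{-1,p}^p:=\sup_{0<r<1}\frac1{2\pi}\int_0^{2\pi}|f(re^{i\theta})|^p\,d\theta$. For $g\in\mathcal{H}(\mathbb{D})$ and $f\in\mathcal{H}(\mathbb{D})$ put $$T_gf(z)=\int_0^z f(\zeta)g'(\zeta)\,d\zeta\qquad(z\in\mathbb{D}),$$ and let $T_g^n$ be the $n$-th iterate of $T_g$. An operator $L$ is said to be bounded on $A^p_\alpha$ if it maps $A^p_\alpha$ into itself and $\|Lf\|_{\alpha,p}\le C\|f\|_{\alpha,p}$ for some constant $C<\infty$ and all $f\in A^p_\alpha$; put $\|L\|_{\alpha,p}:=\sup\{\|Lf\|_{\alpha,p}: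 f\in A^p_\alpha,\ \|f\|_{\alpha,p}\le1\}$. **Proposition.** For every integer $n>1$ there is a constant $c_n>0$, depending only on $n$ (and on the fixed parameters $p$ and $\alpha$, but not on $g$ or $f$), such that for every $g\in\mathcal{H}(\mathbb{D})$: if $T_g^n$ is bounded on $A^p_\alpha$, then $T_g$ is bounded on $A^p_\alpha$, $$\|T_gf\|_{\alpha,p}^n\le c_n\,\|T_g^nf\|_{\alpha,p}\,\|f\|_{\alpha,p}^{n-1}\qquad(f\in A^p_\alpha),$$ and $\|T_g\|_{\alpha,p}^n\le c_n\,\|T_g^n\|_{\alpha,p}$. In particular, for every $g\in\mathcal{H}(\mathbb{D})$, $T_g^n$ is bounded on $A^p_\alpha$ for some integer $n\ge1$ if and only if $T_g^n$ is bounded on $A^p_\alpha$ for every integer $n\ge1$. -/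

import Mathlib

open MeasureTheory Metric Set
open scoped ENNReal NNReal

noncomputable section

namespace AnalyticParaproduct

/-- The open unit disc of the complex plane. -/
def disc : Set ℂ := ball (0 : ℂ) 1

/-- The space of analytic functions on the unit disc. Functions are total functions `ℂ → ℂ`;
their values outside the disc play no role anywhere below. -/
def Hol : Set (ℂ → ℂ) := {f | DifferentiableOn ℂ f disc}

/-- The probability measure `(α + 1) (1 - |z|²)^α dA(z)` on the unit disc, for `α > -1`, where
`dA` is the area measure divided by `π`. -/
def bergmanMeasure (α : ℝ) : Measure ℂ :=
  (volume.restrict disc).withDensity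
    fun z => ENNReal.ofReal ((α + 1) / Real.pi * (1 - ‖z‖ ^ 2) ^ α)

/-- The probability measure `dθ / (2π)` on `(0, 2π]`. -/
def angleMeasure : Measure ℝ :=
  (ENNReal.ofReal (2 * Real.pi))⁻¹ • volume.restrict (Ioc 0 (2 * Real.pi))

/-- The (quasi-)norm of the weighted Bergman space (`α > -1`, `0 < p < ∞`),
`((α + 1) ∫_𝔻 |f(z)|^p (1 - |z|²)^α dA(z))^(1/p)`, with value `∞` if the integral diverges. -/
def bergmanNorm (α p : ℝ) (f : ℂ → ℂ) : ℝ≥0∞ :=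
  eLpNorm f (ENNReal.ofReal p) (bergmanMeasure α)

/-- The (quasi-)norm of the Hardy space (`0 < p < ∞`),
`sup_{0 < r < 1} ((1 / 2π) ∫_0^{2π} |f(r e^{iθ})|^p dθ)^(1/p)`. -/
def hardyNorm (p : ℝ) (f : ℂ → ℂ) : ℝ≥0∞ :=
  ⨆ r ∈ Ioo (0 : ℝ) 1, eLpNorm (fun θ : ℝ => f (circleMap 0 r θ)) (ENNReal.ofReal p) angleMeasure

/-- `‖f‖_{α,p}`, with the convention that `α = -1` is the Hardy space. -/
def spaceNorm (α p : ℝ) (f : ℂ → ℂ) : ℝ≥0∞ :=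
  if α = -1 then hardyNorm p f else bergmanNorm α p f

/-- The weighted Bergman space `A^p_α` for `α > -1`, and the Hardy space `H^p` for `α = -1`. -/
def bergmanSpace (α p : ℝ) : Set (ℂ → ℂ) := {f | f ∈ Hol ∧ spaceNorm α p f < ∞}

/-- `T_g f(z) = ∫_0^z f(ζ) g'(ζ) dζ`, the integral being taken along the segment from `0` to `z`. -/
def T (g f : ℂ → ℂ) : ℂ → ℂ :=
  fun z => ∫ t in (0 : ℝ)..1, f (t * z) * deriv g (t * z) * z

/-- The operator `L` maps `A^p_α` into itself and is bounded there. -/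
def IsBounded (α p : ℝ) (L : (ℂ → ℂ) → (ℂ → ℂ)) : Prop :=
  ∃ C : ℝ≥0, ∀ f ∈ bergmanSpace α p,
    L f ∈ bergmanSpace α p ∧ spaceNorm α p (L f) ≤ C * spaceNorm α p f

/-- `‖L‖_{α,p} = sup {‖L f‖_{α,p} : f ∈ A^p_α, ‖f‖_{α,p} ≤ 1}`. -/
def operatorNorm (α p : ℝ) (L : (ℂ → ℂ) → (ℂ → ℂ)) : ℝ≥0∞ :=
  ⨆ f ∈ {f | f ∈ bergmanSpace α p ∧ spaceNorm α p f ≤ 1}, spaceNorm α p (L f)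

end AnalyticParaproduct

end

namespace AnalyticParaproduct

open ComplexConjugate

/-! On a fixed circle |z| = ρ put M_k = ∫ |T_g^k f|^p dθ. Everything rests on the log-convexity
M_{k+1}² ≤ C M_k M_{k+2} with C depending only on p (`exists_circlePow_sq_le`). It says that the
ratios M_{k+1}/M_k increase up to a factor C, whence M_1^n ≤ c M_n M_0^{n-1}
(`exists_pow_le_of_sq_le`). A supremum over ρ, or Hölder's inequality in ρ, carries this over to the
norms (`spaceNorm_pow_le_of_circlePow_pow_le`).

For the log-convexity let h, F, u be three consecutive iterates. Then F F' = F h g' = h u', so G =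
F²/2 satisfies G' = h u' and G(0) = 0, and g has disappeared. What is needed is the paraproduct
bound ∫|G|^{p/2} ≤ C (∫|h|^p + ∫|u|^p) on circles (`exists_circlePow_le_add`); replacing h, u by λh,
u/λ and varying λ turns the sum into a product.

The paraproduct bound comes from a Bellman function. With r = p/4, B = |h|² + |u|² + ε and A = |G|²
+ B², the function K A^{r-1} B² + C B^{2r} - A^r is subharmonic for suitable K and C
(`exists_bellman_laplacian_nonneg`), nonnegative at 0 because G(0) = 0, and at most C' B^{2r} -
A^r/2 (`exists_bellman_le`). The mean value inequality gives ∫A^r ≤ 2C' ∫B^{2r}, and then ε tends to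
0. -/

/-! ### Mean value inequality in the coordinates s + iθ -/

theorem hasDerivAt_integral_of_continuousOn {F F' : ℝ → ℝ → ℝ} {a b c : ℝ}
    (hF : ContinuousOn (Function.uncurry F) (Iio c ×ˢ univ))
    (hF' : ContinuousOn (Function.uncurry F') (Iio c ×ˢ univ))
    (hd : ∀ s < c, ∀ θ, HasDerivAt (fun s => F s θ) (F' s θ) s) {s : ℝ} (hs : s < c) :
    HasDerivAt (fun s => ∫ θ in a..b, F s θ) (∫ θ in a..b, F' s θ) s := by
  have hcont : ∀ H : ℝ → ℝ → ℝ, ContinuousOn (Function.uncurry H) (Iio c ×ˢ univ) →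
      ∀ x < c, Continuous (H x) := fun H hH x hx =>
    hH.comp_continuous (f := fun θ : ℝ => (x, θ)) (by fun_prop) fun θ => ⟨hx, mem_univ _⟩
  obtain ⟨d, hsd, hdc⟩ := exists_between hs
  have hK : IsCompact (Icc (s - 1) d ×ˢ uIcc a b) := isCompact_Icc.prod isCompact_uIcc
  have hsub : Icc (s - 1) d ×ˢ uIcc a b ⊆ Iio c ×ˢ (univ : Set ℝ) := fun x hx =>
    ⟨lt_of_le_of_lt hx.1.2 hdc, mem_univ _⟩
  obtain ⟨M, hM⟩ := hK.exists_bound_of_continuousOn (hF'.mono hsub)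
  refine (intervalIntegral.hasDerivAt_integral_of_dominated_loc_of_deriv_le
    (s := Icc (s - 1) d) (bound := fun _ => M) (Icc_mem_nhds (by linarith) hsd) ?_ ?_ ?_ ?_
    intervalIntegrable_const ?_).2
  · filter_upwards [Iio_mem_nhds hs] with x hx
    exact (hcont F hF x hx).aestronglyMeasurable
  · exact (hcont F hF s hs).intervalIntegrable _ _
  · exact (hcont F' hF' s hs).aestronglyMeasurable
  · refine Filter.Eventually.of_forall fun t ht x hx => hM (x, t) ⟨hx, uIoc_subset_uIcc ht⟩
  · exact Filter.Eventually.of_forall fun t _ x hx => hd x (lt_of_le_of_lt hx.2 hdc) t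

/-- A convex function with a finite limit at -∞ is nondecreasing: a negative slope at one point
would persist to the left and force the function to +∞ there. -/
theorem le_of_tendsto_atBot_of_deriv2_nonneg {M M' M'' : ℝ → ℝ} {c L : ℝ}
    (h1 : ∀ s < c, HasDerivAt M (M' s) s) (h2 : ∀ s < c, HasDerivAt M' (M'' s) s)
    (h3 : ∀ s < c, 0 ≤ M'' s) (hL : Filter.Tendsto M Filter.atBot (nhds L)) {s : ℝ}
    (hs : s < c) : L ≤ M s := by
  have hmono' : MonotoneOn M' (Iio c) := by
    refine monotoneOn_of_deriv_nonneg (convex_Iio c)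
      (fun x hx => (h2 x hx).continuousAt.continuousWithinAt) ?_ ?_
    · rw [interior_Iio]
      exact fun x hx => (h2 x hx).differentiableAt.differentiableWithinAt
    · rw [interior_Iio]
      exact fun x hx => by rw [(h2 x hx).deriv]; exact h3 x hx
  have hnonneg : ∀ x < c, 0 ≤ M' x := by
    intro x hx
    by_contra! hneg
    have hbd : ∀ y < x, M x + M' x * (y - x) ≤ M y := by
      intro y hy
      have := Convex.image_sub_le_mul_sub_of_deriv_le (convex_Icc y x) (f := M) (C := M' x)
        (fun z hz => (h1 z (hz.2.trans_lt hx)).continuousAt.continuousWithinAt)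
        (by
          rw [interior_Icc]
          exact fun z hz => (h1 z (hz.2.trans hx)).differentiableAt.differentiableWithinAt)
        (by
          rw [interior_Icc]
          intro z hz
          rw [(h1 z (hz.2.trans hx)).deriv]
          exact hmono' (hz.2.trans hx) hx hz.2.le)
        y (left_mem_Icc.2 hy.le) x (right_mem_Icc.2 hy.le) hy.le
      linarith
    have htop : Filter.Tendsto (fun y => M x + M' x * (y - x)) Filter.atBot Filter.atTop := by
      refine Filter.tendsto_atTop_add_const_left _ _ ?_
      refine Filter.Tendsto.const_mul_atBot_of_neg hneg ?_
      exact Filter.tendsto_atBot_add_const_right _ _ Filter.tendsto_id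
    refine not_tendsto_nhds_of_tendsto_atTop (Filter.tendsto_atTop_mono' _ ?_ htop) L hL
    filter_upwards [Filter.Iio_mem_atBot x] with y hy using hbd y hy
  have hmono : MonotoneOn M (Iio c) := by
    refine monotoneOn_of_deriv_nonneg (convex_Iio c)
      (fun x hx => (h1 x hx).continuousAt.continuousWithinAt) ?_ ?_
    · rw [interior_Iio]
      exact fun x hx => (h1 x hx).differentiableAt.differentiableWithinAt
    · rw [interior_Iio]
      exact fun x hx => by rw [(h1 x hx).deriv]; exact hnonneg x hx
  refine le_of_tendsto hL ?_
  filter_upwards [Filter.Iic_mem_atBot s] with y hy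
  exact hmono (lt_of_le_of_lt hy hs) hs hy

/-- The mean value inequality for a subharmonic function of `s + iθ` that is periodic in `θ`. -/
theorem le_integral_of_subharmonic {ψ ψs ψss ψθ ψθθ : ℝ → ℝ → ℝ} {b c L : ℝ} (hb : 0 ≤ b)
    (c0 : ContinuousOn (Function.uncurry ψ) (Iio c ×ˢ univ))
    (c1 : ContinuousOn (Function.uncurry ψs) (Iio c ×ˢ univ))
    (c2 : ContinuousOn (Function.uncurry ψss) (Iio c ×ˢ univ))
    (c3 : ContinuousOn (Function.uncurry ψθθ) (Iio c ×ˢ univ))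
    (d1 : ∀ s < c, ∀ θ, HasDerivAt (fun s => ψ s θ) (ψs s θ) s)
    (d2 : ∀ s < c, ∀ θ, HasDerivAt (fun s => ψs s θ) (ψss s θ) s)
    (d3 : ∀ s < c, ∀ θ, HasDerivAt (ψθ s) (ψθθ s θ) θ)
    (hper : ∀ s < c, ψθ s b = ψθ s 0)
    (hlap : ∀ s < c, ∀ θ, 0 ≤ ψss s θ + ψθθ s θ)
    (hL : Filter.Tendsto (fun s => ∫ θ in (0 : ℝ)..b, ψ s θ) Filter.atBot (nhds L))
    {s : ℝ} (hs : s < c) : L ≤ ∫ θ in (0 : ℝ)..b, ψ s θ := by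
  have hcont : ∀ H : ℝ → ℝ → ℝ, ContinuousOn (Function.uncurry H) (Iio c ×ˢ univ) →
      ∀ x < c, Continuous (H x) := fun H hH x hx =>
    hH.comp_continuous (f := fun θ : ℝ => (x, θ)) (by fun_prop) fun θ => ⟨hx, mem_univ _⟩
  refine le_of_tendsto_atBot_of_deriv2_nonneg
    (fun s hs => hasDerivAt_integral_of_continuousOn c0 c1 d1 hs)
    (fun s hs => hasDerivAt_integral_of_continuousOn c1 c2 d2 hs) (fun x hx => ?_) hL hs
  -- By periodicity the θθ term integrates to zero, so the second derivative of the mean is the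
  -- integral of the full Laplacian.
  have hz : ∫ θ in (0 : ℝ)..b, ψθθ x θ = 0 := by
    rw [intervalIntegral.integral_eq_sub_of_hasDerivAt (fun θ _ => d3 x hx θ)
      ((hcont _ c3 x hx).intervalIntegrable _ _), hper x hx, sub_self]
  have := intervalIntegral.integral_nonneg (μ := volume) hb (fun θ _ => hlap x hx θ)
  rwa [intervalIntegral.integral_add ((hcont _ c2 x hx).intervalIntegrable _ _)
    ((hcont _ c3 x hx).intervalIntegrable _ _), hz, add_zero] at this

/-! ### The Bellman function: Laplacian and size -/

theorem rpow_le_mul_rpow_of_le_of_le {A B k : ℝ} (s : ℝ) (hk : 1 ≤ k) (hB : 0 < B)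
    (h1 : B ≤ A) (h2 : A ≤ k * B) : A ^ s ≤ k ^ |s| * B ^ s := by
  have hA := hB.trans_le h1
  rcases le_total 0 s with hs | hs
  · rw [abs_of_nonneg hs, ← Real.mul_rpow (by linarith) hB.le]
    exact Real.rpow_le_rpow hA.le h2 hs
  · calc A ^ s ≤ 1 * B ^ s := by
          rw [one_mul]; exact Real.rpow_le_rpow_of_nonpos hB h1 hs
      _ ≤ _ := by
          gcongr
          exact Real.one_le_rpow hk (abs_nonneg s)

/-- This bounds the Laplacian of c₂ A^(r-1) B² - A^r divided by A^(r-1). The good term is 8BD, from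
B ΔB. The other terms of the first summand, apart from 2|∇B|² ≥ 0, carry an extra factor B/√A and
total at most c₁ (B/√A) BD. The term -A^r costs at most c₂ BD, which explains 7 = 8 - 1. -/
theorem bellman_bracket_ge {r A B D LA SAA SAB SBB c₁ c₂ : ℝ} (hr : 0 < r)
    (hB : 0 < B) (hAB : B ^ 2 ≤ A) (hD : 0 ≤ D) (hSBB : 0 ≤ SBB) (hSBB' : SBB ≤ 4 * B * D)
    (hLA : 0 ≤ LA) (hLA' : LA ≤ 20 * B * D) (hSAA : 0 ≤ SAA) (hSAA' : SAA ≤ 32 * A * B * D)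
    (hSAB : SAB ^ 2 ≤ SAA * SBB)
    (hc₁ : c₁ = 32 * |(r - 1) * (r - 2)| + 68 * |r - 1|) (hc₂ : c₂ = r * (32 * |r - 1| + 20)) :
    c₂ * (7 - c₁ * (B / √A)) * (B * D) ≤
      c₂ * ((r - 1) * (r - 2) * (SAA * B ^ 2 / A ^ 2) + (r - 1) * (LA * B ^ 2 / A)
        + 4 * (r - 1) * (B * SAB / A) + 2 * SBB + 8 * (B * D)) - r * ((r - 1) * (SAA / A) + LA) := by
  obtain ⟨N, hN, rfl⟩ : ∃ N, 0 < N ∧ A = N ^ 2 :=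
    ⟨√A, Real.sqrt_pos.2 (by nlinarith), (Real.sq_sqrt (by nlinarith)).symm⟩
  rw [Real.sqrt_sq hN.le]
  have hBN : B ≤ N := by nlinarith
  have hBD : 0 ≤ B * D := by positivity
  have hy1 : B / N ≤ 1 := (div_le_one hN).2 hBN
  have hy0 : 0 ≤ B / N := by positivity
  set W := B * D * (B / N) with hW
  have hyy : B * D * (B / N) ^ 2 ≤ W := by
    rw [hW]; gcongr; nlinarith
  have hW0 : 0 ≤ W := by positivity
  have hT1 : |SAA * B ^ 2 / (N ^ 2) ^ 2| ≤ 32 * W := by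
    rw [abs_of_nonneg (by positivity)]
    calc _ ≤ (32 * N ^ 2 * B * D) * B ^ 2 / (N ^ 2) ^ 2 := by gcongr
      _ = 32 * (B * D * (B / N) ^ 2) := by field_simp
      _ ≤ _ := by linarith
  have hT2 : |LA * B ^ 2 / N ^ 2| ≤ 20 * W := by
    rw [abs_of_nonneg (by positivity)]
    calc _ ≤ (20 * B * D) * B ^ 2 / N ^ 2 := by gcongr
      _ = 20 * (B * D * (B / N) ^ 2) := by field_simp
      _ ≤ _ := by linarith
  -- Cauchy–Schwarz gives the square 32 · 4 = 128 ≤ 12². The resulting 4 · 12, added to the 20 of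
  -- `hT2`, is the 68 in `c₁`.
  have hSAB' : |SAB| ≤ 12 * B * N * D := by
    refine abs_le_of_sq_le_sq ?_ (by positivity)
    calc SAB ^ 2 ≤ (32 * N ^ 2 * B * D) * (4 * B * D) := hSAB.trans (by gcongr)
      _ ≤ (12 * B * N * D) ^ 2 := by nlinarith [sq_nonneg (B * N * D)]
  have hT3 : |B * SAB / N ^ 2| ≤ 12 * W := by
    rw [abs_div, abs_mul, abs_of_pos hB, abs_of_pos (a := N ^ 2) (by positivity)]
    calc _ ≤ B * (12 * B * N * D) / N ^ 2 := by gcongr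
      _ = 12 * W := by rw [hW]; field_simp
  have hT4 : |SAA / N ^ 2| ≤ 32 * (B * D) := by
    rw [abs_of_nonneg (by positivity), div_le_iff₀ (by positivity)]
    linarith
  have key : ∀ a x b : ℝ, |x| ≤ b → -(|a| * b) ≤ a * x := fun a x b h => by
    have h1 := neg_abs_le (a * x)
    rw [abs_mul] at h1
    have := mul_le_mul_of_nonneg_left h (abs_nonneg a)
    linarith
  have k1 := key ((r - 1) * (r - 2)) _ _ hT1
  have k2 := key (r - 1) _ _ hT2
  have k3 := key (r - 1) _ _ hT3
  have k4 : (r - 1) * (SAA / N ^ 2) ≤ |r - 1| * (32 * (B * D)) := by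
    have := key (-(r - 1)) _ _ hT4
    rw [abs_neg] at this
    linarith
  have hc₂0 : 0 ≤ c₂ := by rw [hc₂]; positivity
  have e1 : 8 * (B * D) - c₁ * W ≤
      (r - 1) * (r - 2) * (SAA * B ^ 2 / (N ^ 2) ^ 2) + (r - 1) * (LA * B ^ 2 / N ^ 2)
        + 4 * (r - 1) * (B * SAB / N ^ 2) + 2 * SBB + 8 * (B * D) := by
    rw [hc₁]; linarith
  have e2 : r * ((r - 1) * (SAA / N ^ 2) + LA) ≤ c₂ * (B * D) := by
    rw [hc₂, mul_assoc]
    refine mul_le_mul_of_nonneg_left ?_ hr.le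
    linarith
  have e3 := mul_le_mul_of_nonneg_left e1 hc₂0
  have e4 : c₂ * (7 - c₁ * (B / N)) * (B * D) = c₂ * (8 * (B * D) - c₁ * W) - c₂ * (B * D) := by
    rw [hW]; ring
  linarith

/-- The trace of the Hessian of `K A^(r-1) B² + C B^(2r) - A^r`, for suitable constants. -/
theorem exists_bellman_laplacian_nonneg {r : ℝ} (hr : 0 < r) : ∃ K C : ℝ, 0 ≤ K ∧ 1 ≤ C ∧
    ∀ A B D LA SAA SAB SBB : ℝ, 0 < B → B ^ 2 ≤ A → 0 ≤ D → 0 ≤ SBB → SBB ≤ 4 * B * D →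
      0 ≤ LA → LA ≤ 20 * B * D → 0 ≤ SAA → SAA ≤ 32 * A * B * D → SAB ^ 2 ≤ SAA * SBB →
      0 ≤ K * ((r - 1) * (r - 1 - 1) * A ^ (r - 1 - 1 - 1) * SAA * B ^ 2
            + (r - 1) * A ^ (r - 1 - 1) * LA * B ^ 2 + 4 * (r - 1) * A ^ (r - 1 - 1) * B * SAB
            + A ^ (r - 1) * (2 * SBB + 2 * B * (4 * D)))
          + C * (2 * r) * ((2 * r - 1) * B ^ (2 * r - 1 - 1) * SBB + B ^ (2 * r - 1) * (4 * D))
          - r * ((r - 1) * A ^ (r - 1 - 1) * SAA + A ^ (r - 1) * LA) := by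
  obtain ⟨c₁, hc₁⟩ : ∃ c₁, c₁ = 32 * |(r - 1) * (r - 2)| + 68 * |r - 1| := ⟨_, rfl⟩
  obtain ⟨c₂, hc₂⟩ : ∃ c₂, c₂ = r * (32 * |r - 1| + 20) := ⟨_, rfl⟩
  obtain ⟨k, hk⟩ : ∃ k, k = max 1 (c₁ / 7) := ⟨_, rfl⟩
  have hk1 : 1 ≤ k := hk ▸ le_max_left _ _
  have hc₁0 : 0 ≤ c₁ := by rw [hc₁]; positivity
  have hc₂0 : 0 ≤ c₂ := by rw [hc₂]; positivity
  obtain ⟨m, hm⟩ : ∃ m, m = min 1 (2 * r) := ⟨_, rfl⟩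
  have hm0 : 0 < m := hm ▸ lt_min one_pos (by linarith)
  obtain ⟨κ, hκ⟩ : ∃ κ, κ = (k ^ 2) ^ |r - 1| := ⟨_, rfl⟩
  have hκ0 : 0 ≤ κ := by rw [hκ]; positivity
  -- C is large enough for the Laplacian of C B^(2r) to absorb the possibly negative bracket when √A
  -- ≤ kB; C ≥ 1 serves the value at the origin.
  refine ⟨c₂, max 1 (c₁ * c₂ * κ / (8 * r * m)), hc₂0, le_max_left _ _, ?_⟩
  intro A B D LA SAA SAB SBB hB hAB hD hSBB hSBB' hLA hLA' hSAA hSAA' hSAB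
  have hC := le_max_right 1 (c₁ * c₂ * κ / (8 * r * m))
  rw [div_le_iff₀ (by positivity)] at hC
  set C := max 1 (c₁ * c₂ * κ / (8 * r * m))
  have hC0 : 0 ≤ C := zero_le_one.trans (le_max_left _ _)
  have hA : 0 < A := lt_of_lt_of_le (by positivity) hAB
  have hmain := bellman_bracket_ge hr hB hAB hD hSBB hSBB' hLA hLA' hSAA hSAA' hSAB hc₁ hc₂
  rw [Real.rpow_sub_one hA.ne', Real.rpow_sub_one hA.ne', Real.rpow_sub_one hB.ne']
  have hE0 : 0 < A ^ (r - 1) := by positivity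
  have hF0 : 0 < B ^ (2 * r - 1) := by positivity
  -- Either A dominates B² and the bracket is already nonnegative, or A and B² are comparable and
  -- powers of A may be exchanged for powers of B.
  have hEF : k * B < √A ∨ A ^ (r - 1) * B ≤ κ * B ^ (2 * r - 1) := by
    refine or_iff_not_imp_left.2 fun h => ?_
    push Not at h
    have hA2 : A ≤ k ^ 2 * B ^ 2 := by
      rw [← mul_pow, ← Real.sq_sqrt hA.le]
      gcongr
    have h1 := rpow_le_mul_rpow_of_le_of_le (r - 1) (one_le_pow₀ hk1) (by positivity) hAB hA2
    rw [← hκ, ← Real.rpow_natCast B 2, ← Real.rpow_mul hB.le] at h1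
    calc _ ≤ κ * B ^ (((2 : ℕ) : ℝ) * (r - 1)) * B := by gcongr
      _ = κ * B ^ (2 * r - 1) := by
        rw [mul_assoc, ← Real.rpow_add_one hB.ne']
        congr 2; push_cast; ring
  set E := A ^ (r - 1)
  set F := B ^ (2 * r - 1)
  -- B^(2r) is subharmonic even for 2r < 1, because |∇B|² ≤ B ΔB; the factor m = min(1, 2r) is what
  -- survives.
  have hCpart : C * (2 * r) * (F * (4 * D * m)) ≤
      C * (2 * r) * ((2 * r - 1) * (F / B) * SBB + F * (4 * D)) := by
    refine mul_le_mul_of_nonneg_left ?_ (by positivity)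
    have : (2 * r - 1) * (F / B) * SBB + F * (4 * D) = F * ((2 * r - 1) * (SBB / B) + 4 * D) := by
      field_simp
    rw [this]
    refine mul_le_mul_of_nonneg_left ?_ hF0.le
    have hs0 : 0 ≤ SBB / B := by positivity
    have hs1 : SBB / B ≤ 4 * D := by rw [div_le_iff₀ hB]; linarith
    rcases le_total (2 * r) 1 with h | h
    · rw [hm, min_eq_right h]
      linarith [mul_le_mul_of_nonneg_left hs1 (show 0 ≤ 1 - 2 * r by linarith)]
    · rw [hm, min_eq_left h]
      linarith [mul_nonneg (show 0 ≤ 2 * r - 1 by linarith) hs0]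
  set Z := c₂ * ((r - 1) * (r - 2) * (SAA * B ^ 2 / A ^ 2) + (r - 1) * (LA * B ^ 2 / A)
        + 4 * (r - 1) * (B * SAB / A) + 2 * SBB + 8 * (B * D)) - r * ((r - 1) * (SAA / A) + LA)
    with hZ
  have htot : c₂ * ((r - 1) * (r - 1 - 1) * (E / A / A) * SAA * B ^ 2
            + (r - 1) * (E / A) * LA * B ^ 2 + 4 * (r - 1) * (E / A) * B * SAB
            + E * (2 * SBB + 2 * B * (4 * D)))
          + C * (2 * r) * ((2 * r - 1) * (F / B) * SBB + F * (4 * D))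
          - r * ((r - 1) * (E / A) * SAA + E * LA) =
      E * Z + C * (2 * r) * ((2 * r - 1) * (F / B) * SBB + F * (4 * D)) := by
    rw [hZ]; field_simp; ring
  rw [htot]
  have hCnn : 0 ≤ C * (2 * r) * (F * (4 * D * m)) := by positivity
  have hEZ := mul_le_mul_of_nonneg_left hmain hE0.le
  rcases hEF with h | h
  · have hy : c₁ * (B / √A) ≤ 7 := by
      have hsA : 0 < √A := Real.sqrt_pos.2 hA
      rw [← mul_div_assoc, div_le_iff₀ hsA]
      have h7 : c₁ / 7 * B ≤ k * B := by
        rw [hk]; exact mul_le_mul_of_nonneg_right (le_max_right _ _) hB.le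
      linarith
    have : 0 ≤ E * (c₂ * (7 - c₁ * (B / √A)) * (B * D)) := by
      have : 0 ≤ 7 - c₁ * (B / √A) := by linarith
      positivity
    linarith
  · have hy : B / √A ≤ 1 := by
      refine div_le_one_of_le₀ (Real.le_sqrt_of_sq_le hAB) (Real.sqrt_nonneg _)
    have h1 : -(c₁ * c₂ * (E * B) * D) ≤ E * (c₂ * (7 - c₁ * (B / √A)) * (B * D)) := by
      have h2 : -c₁ ≤ 7 - c₁ * (B / √A) := by
        linarith [mul_le_of_le_one_right hc₁0 hy]
      have h3 := mul_le_mul_of_nonneg_left h2 (show 0 ≤ E * c₂ * (B * D) by positivity)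
      calc _ = E * c₂ * (B * D) * -c₁ := by ring
        _ ≤ _ := h3
        _ = _ := by ring
    have h2 : c₁ * c₂ * (E * B) * D ≤ c₁ * c₂ * (κ * F) * D := by gcongr
    have h3 : c₁ * c₂ * κ * (F * D) ≤ C * (8 * r * m) * (F * D) := by gcongr
    have h4 : C * (8 * r * m) * (F * D) = C * (2 * r) * (F * (4 * D * m)) := by ring
    have h5 : c₁ * c₂ * (κ * F) * D = c₁ * c₂ * κ * (F * D) := by ring
    linarith

theorem exists_bellman_le {r K C : ℝ} (hK : 0 ≤ K) (hC : 0 ≤ C) : ∃ C' : ℝ, 0 ≤ C' ∧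
    ∀ A B : ℝ, 0 < B → B ^ 2 ≤ A →
      K * (A ^ (r - 1) * B ^ 2) + C * B ^ (2 * r) - A ^ r ≤ C' * B ^ (2 * r) - A ^ r / 2 := by
  -- Above the threshold A = (2K+1)B² the mixed term is at most A^r/2; below it A is comparable to
  -- B² and the mixed term is a multiple of B^(2r).
  refine ⟨K * (2 * K + 1) ^ |r - 1| + C, by positivity, fun A B hB hAB => ?_⟩
  have hA : 0 < A := lt_of_lt_of_le (by positivity) hAB
  have hE : A ^ r = A ^ (r - 1) * A := by rw [← Real.rpow_add_one hA.ne']; congr 1; ring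
  have hE0 : 0 < A ^ (r - 1) := by positivity
  have hB2r : (B ^ 2) ^ (r - 1) * B ^ 2 = B ^ (2 * r) := by
    rw [← Real.rpow_add_one (by positivity), ← Real.rpow_natCast B 2, ← Real.rpow_mul hB.le]
    congr 1; push_cast; ring
  have hF0 : 0 < B ^ (2 * r) := by positivity
  rcases le_total A ((2 * K + 1) * B ^ 2) with h | h
  · have h1 := rpow_le_mul_rpow_of_le_of_le (r - 1) (by linarith) (by positivity) hAB h
    have h2 : K * (A ^ (r - 1) * B ^ 2) ≤ K * (2 * K + 1) ^ |r - 1| * B ^ (2 * r) := by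
      rw [← hB2r, mul_assoc, ← mul_assoc (_ ^ |r - 1|)]
      gcongr
    have : 0 < A ^ r := by positivity
    linarith
  · have h1 : K * (A ^ (r - 1) * B ^ 2) ≤ A ^ r / 2 := by
      rw [hE]
      nlinarith [sq_nonneg B]
    have : 0 ≤ K * (2 * K + 1) ^ |r - 1| * B ^ (2 * r) := by positivity
    linarith

/-- `K A^(r-1) B² + C B^(2r) - A^r`. -/
noncomputable def bellman (K C r A B : ℝ) : ℝ :=
  K * (A ^ (r - 1) * B ^ 2) + C * B ^ (2 * r) - A ^ r

/-- The first derivative of `bellman` along a curve with velocity `(A₁, B₁)`. -/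
noncomputable def bellman₁ (K C r A B A₁ B₁ : ℝ) : ℝ :=
  K * ((r - 1) * A ^ (r - 1 - 1) * A₁ * B ^ 2 + A ^ (r - 1) * (2 * B * B₁))
    + C * (2 * r * B ^ (2 * r - 1) * B₁) - r * A ^ (r - 1) * A₁

/-- The second derivative of `bellman` along a curve with velocity `(A₁, B₁)` and
acceleration `(A₂, B₂)`. -/
noncomputable def bellman₂ (K C r A B A₁ B₁ A₂ B₂ : ℝ) : ℝ :=
  K * ((r - 1) * (r - 1 - 1) * A ^ (r - 1 - 1 - 1) * A₁ ^ 2 * B ^ 2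
      + (r - 1) * A ^ (r - 1 - 1) * A₂ * B ^ 2 + 4 * (r - 1) * A ^ (r - 1 - 1) * B * (A₁ * B₁)
      + A ^ (r - 1) * (2 * B₁ ^ 2 + 2 * B * B₂))
    + C * (2 * r) * ((2 * r - 1) * B ^ (2 * r - 1 - 1) * B₁ ^ 2 + B ^ (2 * r - 1) * B₂)
    - r * ((r - 1) * A ^ (r - 1 - 1) * A₁ ^ 2 + A ^ (r - 1) * A₂)

theorem hasDerivAt_bellman {K C r t A₁ B₁ : ℝ} {A B : ℝ → ℝ} (hA : HasDerivAt A A₁ t)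
    (hB : HasDerivAt B B₁ t) (hA0 : 0 < A t) (hB0 : 0 < B t) :
    HasDerivAt (fun t => bellman K C r (A t) (B t)) (bellman₁ K C r (A t) (B t) A₁ B₁) t := by
  have h := ((((hA.rpow_const (p := r - 1) (Or.inl hA0.ne')).mul (hB.pow 2)).const_mul K).add
    ((hB.rpow_const (p := 2 * r) (Or.inl hB0.ne')).const_mul C)).sub
      (hA.rpow_const (p := r) (Or.inl hA0.ne'))
  refine h.congr_deriv ?_
  simp only [bellman₁, Pi.pow_apply]
  push_cast
  ring

theorem hasDerivAt_bellman₁ {K C r t A₂ B₂ : ℝ} {A B A₁ B₁ : ℝ → ℝ}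
    (hA : HasDerivAt A (A₁ t) t) (hB : HasDerivAt B (B₁ t) t) (hA₁ : HasDerivAt A₁ A₂ t)
    (hB₁ : HasDerivAt B₁ B₂ t) (hA0 : 0 < A t) (hB0 : 0 < B t) :
    HasDerivAt (fun t => bellman₁ K C r (A t) (B t) (A₁ t) (B₁ t))
      (bellman₂ K C r (A t) (B t) (A₁ t) (B₁ t) A₂ B₂) t := by
  have a1 := hA.rpow_const (p := r - 1) (Or.inl hA0.ne')
  have a2 := hA.rpow_const (p := r - 1 - 1) (Or.inl hA0.ne')
  have b1 := hB.rpow_const (p := 2 * r - 1) (Or.inl hB0.ne')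
  have h := ((((((a2.const_mul (r - 1)).mul hA₁).mul (hB.pow 2)).add
    (a1.mul ((hB.const_mul 2).mul hB₁))).const_mul K).add
    (((b1.const_mul (2 * r)).mul hB₁).const_mul C)).sub ((a1.const_mul r).mul hA₁)
  refine h.congr_deriv ?_
  simp only [bellman₂, Pi.pow_apply, Pi.mul_apply]
  push_cast
  ring

/-! ### Calculus along the radial (e = 1) and angular (e = i) flows -/

/-- `Φ₁` is the derivative of `Φ` on the disc along the flow `z ↦ z exp (t e)`. -/
def HasFlowDeriv {E : Type*} [NormedAddCommGroup E] [NormedSpace ℝ E] (e : ℂ) (Φ Φ₁ : ℂ → E) :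
    Prop :=
  ∀ z ∈ disc, HasDerivAt (fun t : ℝ => Φ (z * Complex.exp (t * e))) (Φ₁ z) 0

/-- The Euler derivative `z f'(z)`. -/
noncomputable def euler (f : ℂ → ℂ) : ℂ → ℂ := fun z => z * deriv f z

theorem isOpen_disc : IsOpen disc := isOpen_ball

theorem differentiableOn_euler {f : ℂ → ℂ} (hf : DifferentiableOn ℂ f disc) :
    DifferentiableOn ℂ (euler f) disc :=
  differentiableOn_id.mul (hf.deriv isOpen_disc)

theorem hasDerivAt_mul_exp (z e : ℂ) (t : ℝ) :
    HasDerivAt (fun t : ℝ => z * Complex.exp (t * e)) (e * (z * Complex.exp (t * e))) t := by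
  have h := (((Complex.ofRealCLM.hasDerivAt (x := t)).mul_const e).cexp).const_mul z
  refine h.congr_deriv ?_
  simp
  ring

theorem hasFlowDeriv_of_differentiableOn {f : ℂ → ℂ} (hf : DifferentiableOn ℂ f disc) (e : ℂ) :
    HasFlowDeriv e f (fun z => e * euler f z) := by
  intro z hz
  have h1 := hasDerivAt_mul_exp z e 0
  have h2 : HasDerivAt f (deriv f z) (z * Complex.exp ((0 : ℝ) * e)) := by
    simpa using ((hf z hz).differentiableAt (isOpen_disc.mem_nhds hz)).hasDerivAt
  refine (h2.comp_of_eq (0 : ℝ) h1 rfl).congr_deriv ?_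
  simp [euler]
  ring

/-- The flow is a one-parameter group, so differentiability at time 0 from every point of the disc
gives it at every time at which the orbit lies in the disc. -/
theorem HasFlowDeriv.hasDerivAt_exp_add {Φ Φ₁ : ℂ → ℝ} {e : ℂ} (h : HasFlowDeriv e Φ Φ₁) {w : ℂ}
    {t : ℝ} (ht : Complex.exp (w + t * e) ∈ disc) :
    HasDerivAt (fun t : ℝ => Φ (Complex.exp (w + t * e))) (Φ₁ (Complex.exp (w + t * e))) t := by
  have h1 := h _ ht
  have h2 : HasDerivAt (fun x : ℝ => x - t) 1 t := (hasDerivAt_id t).sub_const t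
  have h3 := h1.scomp_of_eq t h2 (by simp)
  rw [one_smul] at h3
  convert! h3 using 1
  ext x
  simp only [Function.comp, ← Complex.exp_add]
  congr 2
  push_cast
  ring

/-- The constant k allows both derivatives of |f|² to be read off: k = 1 with g = f for the first, k
= 2e with g the Euler derivative for the second. -/
theorem HasFlowDeriv.re_mul_conj_mul {f g f₁ g₁ : ℂ → ℂ} {e : ℂ} (hf : HasFlowDeriv e f f₁)
    (hg : HasFlowDeriv e g g₁) (k : ℂ) :
    HasFlowDeriv e (fun z => (k * (conj (f z) * g z)).re)
      (fun z => (k * (conj (f₁ z) * g z + conj (f z) * g₁ z)).re) := by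
  intro z hz
  have h1 : HasDerivAt (fun t : ℝ => conj (f (z * Complex.exp (t * e)))) (conj (f₁ z)) 0 :=
    (hf z hz).star
  have h := Complex.reCLM.hasFDerivAt.comp_hasDerivAt (0 : ℝ) ((h1.mul (hg z hz)).const_mul k)
  refine h.congr_deriv ?_
  simp

theorem normSq_eq_re (w : ℂ) : Complex.normSq w = (1 * (conj w * w)).re := by
  rw [one_mul, ← Complex.normSq_eq_conj_mul_self, Complex.ofReal_re]

/-- The flow derivative of `|f|²`. -/
noncomputable def flowSq₁ (e : ℂ) (f : ℂ → ℂ) (z : ℂ) : ℝ :=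
  (2 * e * (conj (f z) * euler f z)).re

/-- The second flow derivative of `|f|²`. -/
noncomputable def flowSq₂ (e : ℂ) (f : ℂ → ℂ) (z : ℂ) : ℝ :=
  (2 * e * (conj (e * euler f z) * euler f z + conj (f z) * (e * euler (euler f) z))).re

theorem hasFlowDeriv_normSq {f : ℂ → ℂ} (hf : DifferentiableOn ℂ f disc) (e : ℂ) :
    HasFlowDeriv e (fun z => Complex.normSq (f z)) (flowSq₁ e f) := by
  intro z hz
  have h := (hasFlowDeriv_of_differentiableOn hf e).re_mul_conj_mul
    (hasFlowDeriv_of_differentiableOn hf e) 1 z hz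
  simp only [← normSq_eq_re] at h
  refine h.congr_deriv ?_
  simp only [flowSq₁, map_mul]
  simp
  ring

theorem hasFlowDeriv_flowSq₁ {f : ℂ → ℂ} (hf : DifferentiableOn ℂ f disc) (e : ℂ) :
    HasFlowDeriv e (flowSq₁ e f) (flowSq₂ e f) :=
  (hasFlowDeriv_of_differentiableOn hf e).re_mul_conj_mul
    (hasFlowDeriv_of_differentiableOn (differentiableOn_euler hf) e) (2 * e)

theorem continuousOn_normSq {f : ℂ → ℂ} (hf : DifferentiableOn ℂ f disc) :
    ContinuousOn (fun z => Complex.normSq (f z)) disc :=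
  Complex.continuous_normSq.comp_continuousOn hf.continuousOn

theorem continuousOn_flowSq₁ {f : ℂ → ℂ} (hf : DifferentiableOn ℂ f disc) (e : ℂ) :
    ContinuousOn (flowSq₁ e f) disc := by
  have h0 := hf.continuousOn
  have h1 := (differentiableOn_euler hf).continuousOn
  have h2 : ContinuousOn (fun z => conj (f z)) disc := Complex.continuous_conj.comp_continuousOn h0
  exact Complex.continuous_re.comp_continuousOn (continuousOn_const.mul (h2.mul h1))

theorem continuousOn_flowSq₂ {f : ℂ → ℂ} (hf : DifferentiableOn ℂ f disc) (e : ℂ) :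
    ContinuousOn (flowSq₂ e f) disc := by
  have h0 := hf.continuousOn
  have h1 := (differentiableOn_euler hf).continuousOn
  have h3 := (differentiableOn_euler (differentiableOn_euler hf)).continuousOn
  have h2 : ContinuousOn (fun z => conj (f z)) disc := Complex.continuous_conj.comp_continuousOn h0
  have h4 : ContinuousOn (fun z => conj (e * euler f z)) disc :=
    Complex.continuous_conj.comp_continuousOn (continuousOn_const.mul h1)
  exact Complex.continuous_re.comp_continuousOn
    (continuousOn_const.mul ((h4.mul h1).add (h2.mul (continuousOn_const.mul h3))))

/-- The terms with the second Euler derivative carry e², which is 1 and -1 for the two flows, and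
cancel; those with |e|² add up. -/
theorem flowSq₂_one_add_flowSq₂_I (f : ℂ → ℂ) (z : ℂ) :
    flowSq₂ 1 f z + flowSq₂ Complex.I f z = 4 * Complex.normSq (euler f z) := by
  simp [flowSq₂, Complex.normSq_apply]
  ring

/-- A real function on the disc with its first and second derivatives along a flow. -/
structure FlowJet (e : ℂ) (Φ Φ₁ Φ₂ : ℂ → ℝ) : Prop where
  deriv₁ : HasFlowDeriv e Φ Φ₁
  deriv₂ : HasFlowDeriv e Φ₁ Φ₂
  cont₀ : ContinuousOn Φ disc
  cont₁ : ContinuousOn Φ₁ disc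
  cont₂ : ContinuousOn Φ₂ disc

theorem flowJet_normSq {f : ℂ → ℂ} (hf : DifferentiableOn ℂ f disc) (e : ℂ) :
    FlowJet e (fun z => Complex.normSq (f z)) (flowSq₁ e f) (flowSq₂ e f) :=
  ⟨hasFlowDeriv_normSq hf e, hasFlowDeriv_flowSq₁ hf e, continuousOn_normSq hf,
    continuousOn_flowSq₁ hf e, continuousOn_flowSq₂ hf e⟩

theorem FlowJet.add {e : ℂ} {Φ Φ₁ Φ₂ Ψ Ψ₁ Ψ₂ : ℂ → ℝ} (h : FlowJet e Φ Φ₁ Φ₂)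
    (k : FlowJet e Ψ Ψ₁ Ψ₂) : FlowJet e (fun z => Φ z + Ψ z) (fun z => Φ₁ z + Ψ₁ z)
      (fun z => Φ₂ z + Ψ₂ z) :=
  ⟨fun z hz => (h.deriv₁ z hz).add (k.deriv₁ z hz), fun z hz => (h.deriv₂ z hz).add (k.deriv₂ z hz),
    h.cont₀.add k.cont₀, h.cont₁.add k.cont₁, h.cont₂.add k.cont₂⟩

theorem FlowJet.add_const {e : ℂ} {Φ Φ₁ Φ₂ : ℂ → ℝ} (h : FlowJet e Φ Φ₁ Φ₂) (c : ℝ) :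
    FlowJet e (fun z => Φ z + c) Φ₁ Φ₂ :=
  ⟨fun z hz => (h.deriv₁ z hz).add_const c, h.deriv₂, h.cont₀.add continuousOn_const, h.cont₁,
    h.cont₂⟩

theorem FlowJet.sq {e : ℂ} {Φ Φ₁ Φ₂ : ℂ → ℝ} (h : FlowJet e Φ Φ₁ Φ₂) :
    FlowJet e (fun z => Φ z ^ 2) (fun z => 2 * Φ z * Φ₁ z)
      (fun z => 2 * Φ₁ z ^ 2 + 2 * Φ z * Φ₂ z) := by
  refine ⟨fun z hz => ?_, fun z hz => ?_, h.cont₀.pow 2,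
    (continuousOn_const.mul h.cont₀).mul h.cont₁,
    (continuousOn_const.mul (h.cont₁.pow 2)).add ((continuousOn_const.mul h.cont₀).mul h.cont₂)⟩
  · refine ((h.deriv₁ z hz).pow 2).congr_deriv ?_
    simp
  · refine (((h.deriv₁ z hz).const_mul 2).mul (h.deriv₂ z hz)).congr_deriv ?_
    simp
    ring

theorem FlowJet.bellman {e : ℂ} {A A₁ A₂ B B₁ B₂ : ℂ → ℝ} (hA : FlowJet e A A₁ A₂)
    (hB : FlowJet e B B₁ B₂) (hA0 : ∀ z, 0 < A z) (hB0 : ∀ z, 0 < B z) (K C r : ℝ) :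
    FlowJet e (fun z => bellman K C r (A z) (B z))
      (fun z => bellman₁ K C r (A z) (B z) (A₁ z) (B₁ z))
      (fun z => bellman₂ K C r (A z) (B z) (A₁ z) (B₁ z) (A₂ z) (B₂ z)) := by
  have hAr : ∀ s : ℝ, ContinuousOn (fun z => A z ^ s) disc := fun s =>
    hA.cont₀.rpow_const fun z _ => Or.inl (hA0 z).ne'
  have hBr : ∀ s : ℝ, ContinuousOn (fun z => B z ^ s) disc := fun s =>
    hB.cont₀.rpow_const fun z _ => Or.inl (hB0 z).ne'
  have a1 := hAr r
  have a2 := hAr (r - 1)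
  have a3 := hAr (r - 1 - 1)
  have a4 := hAr (r - 1 - 1 - 1)
  have b1 := hBr (2 * r)
  have b2 := hBr (2 * r - 1)
  have b3 := hBr (2 * r - 1 - 1)
  have c0 := hA.cont₀
  have c1 := hA.cont₁
  have c2 := hA.cont₂
  have c3 := hB.cont₀
  have c4 := hB.cont₁
  have c5 := hB.cont₂
  refine ⟨fun z hz => ?_, fun z hz => ?_, ?_, ?_, ?_⟩
  · have := hasDerivAt_bellman (K := K) (C := C) (r := r) (hA.deriv₁ z hz) (hB.deriv₁ z hz)
      (hA0 _) (hB0 _)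
    simpa using this
  · have := hasDerivAt_bellman₁ (K := K) (C := C) (r := r)
      (A := fun t : ℝ => A (z * Complex.exp (t * e))) (B := fun t : ℝ => B (z * Complex.exp (t * e)))
      (A₁ := fun t : ℝ => A₁ (z * Complex.exp (t * e)))
      (B₁ := fun t : ℝ => B₁ (z * Complex.exp (t * e))) (t := 0)
      (by simpa using hA.deriv₁ z hz) (by simpa using hB.deriv₁ z hz)
      (hA.deriv₂ z hz) (hB.deriv₂ z hz) (hA0 _) (hB0 _)
    simpa using this
  · unfold AnalyticParaproduct.bellman; fun_prop
  · unfold bellman₁; fun_prop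
  · unfold bellman₂; fun_prop

/-! ### Subharmonicity on the disc and the circle estimate -/

theorem exp_add_mul_I_mem_disc {s : ℝ} (hs : s < 0) (θ : ℝ) :
    Complex.exp (s + θ * Complex.I) ∈ disc := by
  simp [disc, Complex.norm_exp, hs]

/-- The mean value inequality on circles about the origin. -/
theorem le_integral_circle_of_subharmonic {Φ Φs Φss Φθ Φθθ : ℂ → ℝ} (h1 : FlowJet 1 Φ Φs Φss)
    (h2 : FlowJet Complex.I Φ Φθ Φθθ) (hlap : ∀ z ∈ disc, 0 ≤ Φss z + Φθθ z) {s : ℝ} (hs : s < 0) :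
    2 * Real.pi * Φ 0 ≤ ∫ θ in (0 : ℝ)..2 * Real.pi, Φ (Complex.exp (s + θ * Complex.I)) := by
  have hc : ∀ F : ℂ → ℝ, ContinuousOn F disc →
      ContinuousOn (Function.uncurry fun s θ : ℝ => F (Complex.exp (s + θ * Complex.I)))
        (Iio 0 ×ˢ univ) := fun F hF =>
    hF.comp (f := fun x : ℝ × ℝ => Complex.exp (x.1 + x.2 * Complex.I))
      (by fun_prop) fun x hx => exp_add_mul_I_mem_disc hx.1 x.2
  have hs1 : ∀ F F₁ : ℂ → ℝ, HasFlowDeriv 1 F F₁ → ∀ s < (0 : ℝ), ∀ θ : ℝ,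
      HasDerivAt (fun s : ℝ => F (Complex.exp (s + θ * Complex.I)))
        (F₁ (Complex.exp (s + θ * Complex.I))) s := by
    intro F F₁ h s hs θ
    have := h.hasDerivAt_exp_add (w := θ * Complex.I) (t := s)
      (by simpa [add_comm] using exp_add_mul_I_mem_disc hs θ)
    simpa [add_comm] using this
  refine le_integral_of_subharmonic (c := 0) (b := 2 * Real.pi) (by positivity)
    (hc _ h1.cont₀) (hc _ h1.cont₁) (hc _ h1.cont₂) (hc _ h2.cont₂) (hs1 _ _ h1.deriv₁)
    (hs1 _ _ h1.deriv₂) (ψθ := fun s θ : ℝ => Φθ (Complex.exp (s + θ * Complex.I)))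
    (fun s hs θ => h2.deriv₂.hasDerivAt_exp_add (exp_add_mul_I_mem_disc hs θ)) (fun s _ => ?_)
    (fun s hs θ => hlap _ (exp_add_mul_I_mem_disc hs θ)) ?_ hs
  · have := Complex.exp_periodic (s : ℂ)
    simp [this]
  -- As s → -∞ the circles shrink to the origin and the means tend to 2π Φ(0) by dominated
  -- convergence.
  · have hexp : ∀ θ : ℝ, Filter.Tendsto (fun s : ℝ => Complex.exp (s + θ * Complex.I))
        Filter.atBot (nhds 0) := fun θ => by
      rw [tendsto_zero_iff_norm_tendsto_zero]
      simpa [Complex.norm_exp] using Real.tendsto_exp_atBot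
    have h0 : ContinuousAt Φ 0 := h1.cont₀.continuousAt (isOpen_disc.mem_nhds (by simp [disc]))
    obtain ⟨δ, hδ, hδ'⟩ := Metric.continuousAt_iff.1 h0 1 one_pos
    have hlim := intervalIntegral.tendsto_integral_filter_of_dominated_convergence
      (μ := volume) (a := 0) (b := 2 * Real.pi) (l := Filter.atBot)
      (F := fun (s : ℝ) (θ : ℝ) => Φ (Complex.exp (s + θ * Complex.I))) (f := fun _ => Φ 0)
      (fun _ => |Φ 0| + 1) ?_ ?_ intervalIntegrable_const ?_
    · simpa using hlim
    · filter_upwards [Filter.Iio_mem_atBot 0] with s hs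
      exact ((h1.cont₀.comp_continuous (by fun_prop)
        fun θ => exp_add_mul_I_mem_disc hs θ).aestronglyMeasurable)
    · filter_upwards [Real.tendsto_exp_atBot.eventually (Iio_mem_nhds hδ)] with s hs
      refine Filter.Eventually.of_forall fun θ _ => ?_
      have := hδ' (x := Complex.exp (s + θ * Complex.I)) (by simpa [Complex.norm_exp] using hs)
      rw [Real.dist_eq] at this
      rw [Real.norm_eq_abs]
      linarith [abs_sub_abs_le_abs_sub (Φ (Complex.exp (s + θ * Complex.I))) (Φ 0)]
    · exact Filter.Eventually.of_forall fun θ _ => h0.tendsto.comp (hexp θ)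

theorem re_two_mul_sq_add (Q : ℂ) :
    (2 * 1 * Q).re ^ 2 + (2 * Complex.I * Q).re ^ 2 = 4 * Complex.normSq Q := by
  simp [Complex.normSq_apply]
  ring

theorem normSq_add_le (a b : ℂ) :
    Complex.normSq (a + b) ≤ 2 * (Complex.normSq a + Complex.normSq b) := by
  simp only [Complex.normSq_apply, Complex.add_re, Complex.add_im]
  nlinarith [sq_nonneg (a.re - b.re), sq_nonneg (a.im - b.im)]

/-- Cauchy–Schwarz in ℂ², from Lagrange's identity with remainder |ad - bc|². -/
theorem normSq_conj_mul_add_le (a b c d : ℂ) :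
    Complex.normSq (conj a * c + conj b * d) ≤
      (Complex.normSq a + Complex.normSq b) * (Complex.normSq c + Complex.normSq d) := by
  have h : Complex.normSq (conj a * c + conj b * d) + Complex.normSq (a * d - b * c) =
      (Complex.normSq a + Complex.normSq b) * (Complex.normSq c + Complex.normSq d) := by
    simp [Complex.normSq_apply]
    ring
  linarith [Complex.normSq_nonneg (a * d - b * c)]

/-- The circle estimate with a regularising constant. -/
theorem exists_integral_rpow_le_of_pos {r : ℝ} (hr : 0 < r) : ∃ C : ℝ, 0 ≤ C ∧
    ∀ h u G : ℂ → ℂ, DifferentiableOn ℂ h disc → DifferentiableOn ℂ u disc →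
      DifferentiableOn ℂ G disc → G 0 = 0 → (∀ z ∈ disc, deriv G z = h z * deriv u z) →
      ∀ ε > 0, ∀ s < (0 : ℝ),
        ∫ θ in (0 : ℝ)..2 * Real.pi, Complex.normSq (G (Complex.exp (s + θ * Complex.I))) ^ r ≤
        C * ∫ θ in (0 : ℝ)..2 * Real.pi, (Complex.normSq (h (Complex.exp (s + θ * Complex.I))) +
          Complex.normSq (u (Complex.exp (s + θ * Complex.I))) + ε) ^ (2 * r) := by
  obtain ⟨K, C, hK, hC, hlap⟩ := exists_bellman_laplacian_nonneg hr
  obtain ⟨C', hC', hle⟩ := exists_bellman_le (r := r) hK (zero_le_one.trans hC)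
  refine ⟨2 * C', by positivity, fun h u G hh hu hG hG0 hGd ε hε s hs => ?_⟩
  obtain ⟨B, hBdef⟩ : ∃ B : ℂ → ℝ, B = fun z => Complex.normSq (h z) + Complex.normSq (u z) + ε :=
    ⟨_, rfl⟩
  -- Adding B² keeps A positive at the zeros of G, so all real powers are smooth, and makes A ≥ B²
  -- with equality at 0.
  obtain ⟨A, hAdef⟩ : ∃ A : ℂ → ℝ, A = fun z => Complex.normSq (G z) + B z ^ 2 := ⟨_, rfl⟩
  have jB : ∀ e : ℂ, FlowJet e B (fun z => flowSq₁ e h z + flowSq₁ e u z)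
      (fun z => flowSq₂ e h z + flowSq₂ e u z) := fun e => by
    rw [hBdef]
    exact ((flowJet_normSq hh e).add (flowJet_normSq hu e)).add_const ε
  have jA : ∀ e : ℂ, FlowJet e A
      (fun z => flowSq₁ e G z + 2 * B z * (flowSq₁ e h z + flowSq₁ e u z))
      (fun z => flowSq₂ e G z + (2 * (flowSq₁ e h z + flowSq₁ e u z) ^ 2 +
        2 * B z * (flowSq₂ e h z + flowSq₂ e u z))) := fun e => by
    rw [hAdef]
    exact (flowJet_normSq hG e).add (jB e).sq
  have hB0 : ∀ z, 0 < B z := fun z => by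
    have := Complex.normSq_nonneg (h z)
    have := Complex.normSq_nonneg (u z)
    simp only [hBdef]; positivity
  have hBA : ∀ z, B z ^ 2 ≤ A z := fun z => by
    simp only [hAdef]; linarith [Complex.normSq_nonneg (G z)]
  have hA0 : ∀ z, 0 < A z := fun z => lt_of_lt_of_le (pow_pos (hB0 z) 2) (hBA z)
  have j := fun e : ℂ => (jA e).bellman (jB e) hA0 hB0 K C r
  have hmean := le_integral_circle_of_subharmonic (j 1) (j Complex.I) (fun z hz => ?_) hs
  · have hc : ∀ F : ℂ → ℝ, ContinuousOn F disc →
        Continuous fun θ : ℝ => F (Complex.exp (s + θ * Complex.I)) := fun F hF =>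
      hF.comp_continuous (by fun_prop) fun θ => exp_add_mul_I_mem_disc hs θ
    have cA := hc A (jA 1).cont₀
    have cB := hc B (jB 1).cont₀
    have cG := hc _ (continuousOn_normSq hG)
    have cAr : Continuous fun θ : ℝ => A (Complex.exp (s + θ * Complex.I)) ^ r :=
      cA.rpow_const fun θ => Or.inl (hA0 _).ne'
    have cBr : Continuous fun θ : ℝ => B (Complex.exp (s + θ * Complex.I)) ^ (2 * r) :=
      cB.rpow_const fun θ => Or.inl (hB0 _).ne'
    have cGr : Continuous fun θ : ℝ => Complex.normSq (G (Complex.exp (s + θ * Complex.I))) ^ r :=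
      cG.rpow_const fun θ => Or.inr hr.le
    -- Since G(0) = 0, the value at the origin is (K + C - 1) B(0)^(2r), nonnegative as C ≥ 1.
    have h00 : 0 ≤ 2 * Real.pi * bellman K C r (A 0) (B 0) := by
      have hA00 : A 0 = B 0 ^ 2 := by simp [hAdef, hG0]
      have : A 0 ^ r = B 0 ^ (2 * r) := by
        rw [hA00, ← Real.rpow_natCast, ← Real.rpow_mul (hB0 0).le]
        norm_num
      have hp : 0 ≤ K * (A 0 ^ (r - 1) * B 0 ^ 2) :=
        mul_nonneg hK (mul_nonneg (Real.rpow_nonneg (hA0 0).le _) (sq_nonneg _))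
      have hp2 : 0 ≤ B 0 ^ (2 * r) := Real.rpow_nonneg (hB0 0).le _
      refine mul_nonneg (by positivity) ?_
      rw [bellman, this]
      nlinarith
    have hup : ∫ θ in (0 : ℝ)..2 * Real.pi, bellman K C r (A (Complex.exp (s + θ * Complex.I)))
          (B (Complex.exp (s + θ * Complex.I))) ≤
        ∫ θ in (0 : ℝ)..2 * Real.pi, (C' * B (Complex.exp (s + θ * Complex.I)) ^ (2 * r) -
          A (Complex.exp (s + θ * Complex.I)) ^ r / 2) := by
      refine intervalIntegral.integral_mono (by positivity) ?_ ?_ fun θ => hle _ _ (hB0 _) (hBA _)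
      · exact (hc _ (j 1).cont₀).intervalIntegrable _ _
      · exact ((continuous_const.mul cBr).sub (cAr.div_const 2)).intervalIntegrable _ _
    have hGA : ∫ θ in (0 : ℝ)..2 * Real.pi,
          Complex.normSq (G (Complex.exp (s + θ * Complex.I))) ^ r ≤
        ∫ θ in (0 : ℝ)..2 * Real.pi, A (Complex.exp (s + θ * Complex.I)) ^ r := by
      refine intervalIntegral.integral_mono (by positivity) (cGr.intervalIntegrable _ _)
        (cAr.intervalIntegrable _ _) fun θ => ?_
      refine Real.rpow_le_rpow (Complex.normSq_nonneg _) ?_ hr.le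
      simp only [hAdef]
      linarith [sq_nonneg (B (Complex.exp (s + θ * Complex.I)))]
    rw [intervalIntegral.integral_sub ((cBr.intervalIntegrable _ _).const_mul C')
      ((cAr.intervalIntegrable _ _).div_const 2), intervalIntegral.integral_const_mul,
      intervalIntegral.integral_div] at hup
    rw [hBdef] at hup hmean h00
    linarith
  -- Q and X encode the gradients of B and A: the derivatives along e are Re(2eQ) and Re(2eX), and
  -- ΔB = 4D.
  · set D := Complex.normSq (euler h z) + Complex.normSq (euler u z) with hD
    set Q := conj (h z) * euler h z + conj (u z) * euler u z with hQ
    set X := conj (G z) * euler G z + 2 * (B z : ℂ) * Q with hX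
    have hD0 : 0 ≤ D := add_nonneg (Complex.normSq_nonneg _) (Complex.normSq_nonneg _)
    have eB1 : ∀ e : ℂ, flowSq₁ e h z + flowSq₁ e u z = (2 * e * Q).re := fun e => by
      rw [flowSq₁, flowSq₁, ← Complex.add_re, hQ, mul_add]
    have eA1 : ∀ e : ℂ, flowSq₁ e G z + 2 * B z * (flowSq₁ e h z + flowSq₁ e u z) =
        (2 * e * X).re := fun e => by
      have h1 : 2 * e * X =
          2 * e * (conj (G z) * euler G z) + ((2 * B z : ℝ) : ℂ) * (2 * e * Q) := by
        rw [hX]; push_cast; ring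
      rw [eB1, flowSq₁, h1, Complex.add_re, Complex.re_ofReal_mul]
    have hsB := re_two_mul_sq_add Q
    have hsA := re_two_mul_sq_add X
    have lB : flowSq₂ 1 h z + flowSq₂ 1 u z + (flowSq₂ Complex.I h z + flowSq₂ Complex.I u z) =
        4 * D := by
      rw [hD, mul_add, ← flowSq₂_one_add_flowSq₂_I, ← flowSq₂_one_add_flowSq₂_I]; ring
    have lG := flowSq₂_one_add_flowSq₂_I G z
    have hQB : Complex.normSq Q ≤ B z * D := by
      refine (normSq_conj_mul_add_le _ _ _ _).trans ?_
      gcongr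
      simp only [hBdef]; linarith
    -- The only use of G' = h u'.
    have hGB : Complex.normSq (euler G z) ≤ B z * D := by
      have : euler G z = h z * euler u z := by simp only [euler]; rw [hGd z hz]; ring
      rw [this, map_mul]
      have h1 : Complex.normSq (h z) ≤ B z := by
        simp only [hBdef]; linarith [Complex.normSq_nonneg (u z)]
      have h2 : Complex.normSq (euler u z) ≤ D := by
        rw [hD]; linarith [Complex.normSq_nonneg (euler h z)]
      have := (hB0 z).le
      have := Complex.normSq_nonneg (euler u z)
      gcongr
    have hXA : Complex.normSq X ≤ 8 * A z * B z * D := by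
      refine (normSq_add_le _ _).trans ?_
      rw [map_mul, map_mul, map_mul, Complex.normSq_conj, Complex.normSq_ofReal]
      have hGz := Complex.normSq_nonneg (G z)
      have h1 : Complex.normSq (G z) * Complex.normSq (euler G z) ≤
          Complex.normSq (G z) * (B z * D) := by gcongr
      have h2 : Complex.normSq 2 * (B z * B z) * Complex.normSq Q ≤
          4 * (B z * B z) * (B z * D) := by
        have : Complex.normSq 2 = 4 := by norm_num [Complex.normSq_apply]
        rw [this]
        have := (hB0 z).le
        gcongr
      have h3 : A z = Complex.normSq (G z) + B z ^ 2 := by rw [hAdef]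
      have h4 : 0 ≤ Complex.normSq (G z) * (B z * D) :=
        mul_nonneg hGz (mul_nonneg (hB0 z).le hD0)
      rw [h3]
      linarith
    have hBz := hB0 z
    have hAz := hA0 z
    have key := hlap (A z) (B z) D
      (4 * Complex.normSq (euler G z) + 8 * Complex.normSq Q + 2 * B z * (4 * D))
      (4 * Complex.normSq X)
      ((2 * 1 * X).re * (2 * 1 * Q).re + (2 * Complex.I * X).re * (2 * Complex.I * Q).re)
      (4 * Complex.normSq Q) hBz (hBA z) hD0
      (mul_nonneg (by norm_num) (Complex.normSq_nonneg _)) (by linarith)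
      (by
        have := Complex.normSq_nonneg (euler G z)
        have := Complex.normSq_nonneg Q
        positivity)
      (by linarith) (mul_nonneg (by norm_num) (Complex.normSq_nonneg _)) (by linarith)
      -- Cauchy–Schwarz for the gradients of A and B, with the squared determinant as remainder.
      (by
        rw [← hsA, ← hsB]
        nlinarith [sq_nonneg ((2 * 1 * X).re * (2 * Complex.I * Q).re -
          (2 * Complex.I * X).re * (2 * 1 * Q).re)])
    refine key.trans_eq ?_
    simp only [eA1, bellman₂]
    simp only [eB1]
    rw [← lB, ← lG, mul_assoc, ← hsA]
    have e8 : 8 * Complex.normSq Q = 2 * ((2 * 1 * Q).re ^ 2 + (2 * Complex.I * Q).re ^ 2) := by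
      rw [hsB]; ring
    rw [e8, ← hsB]
    ring

/-! ### Bilinear and log-convexity estimates for circle means -/

/-- The integral of `|f|^p` over the circle of radius `ρ`. -/
noncomputable def circlePow (p ρ : ℝ) (f : ℂ → ℂ) : ℝ :=
  ∫ θ in (0 : ℝ)..2 * Real.pi, ‖f (circleMap 0 ρ θ)‖ ^ p

theorem circlePow_nonneg (p ρ : ℝ) (f : ℂ → ℂ) : 0 ≤ circlePow p ρ f :=
  intervalIntegral.integral_nonneg (by positivity) fun θ _ => Real.rpow_nonneg (norm_nonneg _) _

theorem circleMap_mem_disc {ρ : ℝ} (hρ : ρ ∈ Ioo (0 : ℝ) 1) (θ : ℝ) : circleMap 0 ρ θ ∈ disc := by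
  simp [disc, circleMap, abs_of_pos hρ.1, hρ.2]

theorem exp_log_add_mul_I {ρ : ℝ} (hρ : 0 < ρ) (θ : ℝ) :
    Complex.exp (Real.log ρ + θ * Complex.I) = circleMap 0 ρ θ := by
  rw [Complex.exp_add, ← Complex.ofReal_exp, Real.exp_log hρ]
  simp [circleMap]

theorem continuous_comp_circleMap {f : ℂ → ℂ} (hf : f ∈ Hol) {ρ : ℝ} (hρ : ρ ∈ Ioo (0 : ℝ) 1) :
    Continuous fun θ : ℝ => f (circleMap 0 ρ θ) :=
  hf.continuousOn.comp_continuous (continuous_circleMap 0 ρ) fun θ => circleMap_mem_disc hρ θ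

theorem continuous_norm_rpow_comp_circleMap {f : ℂ → ℂ} (hf : f ∈ Hol) {p ρ : ℝ} (hp : 0 < p)
    (hρ : ρ ∈ Ioo (0 : ℝ) 1) : Continuous fun θ : ℝ => ‖f (circleMap 0 ρ θ)‖ ^ p :=
  (continuous_comp_circleMap hf hρ).norm.rpow_const fun _ => Or.inr hp.le

theorem add_add_rpow_le {a b c q : ℝ} (ha : 0 ≤ a) (hb : 0 ≤ b) (hc : 0 ≤ c) (hq : 0 ≤ q) :
    (a + b + c) ^ q ≤ 3 ^ q * (a ^ q + b ^ q + c ^ q) := by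
  have key : ∀ m, 0 ≤ m → a ≤ m → b ≤ m → c ≤ m → (a + b + c) ^ q ≤ 3 ^ q * m ^ q :=
    fun m hm h1 h2 h3 => by
      rw [← Real.mul_rpow (by norm_num) hm]
      exact Real.rpow_le_rpow (by positivity) (by linarith) hq
  have ha' := Real.rpow_nonneg ha q
  have hb' := Real.rpow_nonneg hb q
  have hc' := Real.rpow_nonneg hc q
  have h3 : (0 : ℝ) ≤ 3 ^ q := by positivity
  rcases le_total a b with h | h <;> rcases le_total b c with h' | h' <;>
    rcases le_total a c with h'' | h''
  all_goals first
    | exact (key a ha le_rfl (by linarith) (by linarith)).trans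
        (mul_le_mul_of_nonneg_left (by linarith) h3)
    | exact (key b hb (by linarith) le_rfl (by linarith)).trans
        (mul_le_mul_of_nonneg_left (by linarith) h3)
    | exact (key c hc (by linarith) (by linarith) le_rfl).trans
        (mul_le_mul_of_nonneg_left (by linarith) h3)

theorem normSq_rpow (z : ℂ) (q : ℝ) : Complex.normSq z ^ q = ‖z‖ ^ (2 * q) := by
  rw [Complex.normSq_eq_norm_sq, ← Real.rpow_natCast, ← Real.rpow_mul (norm_nonneg _)]
  norm_num

/-- The bilinear estimate for `G' = h u'` on circles. -/
theorem exists_circlePow_le_add {p : ℝ} (hp : 0 < p) : ∃ C : ℝ, 0 ≤ C ∧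
    ∀ h ∈ Hol, ∀ u ∈ Hol, ∀ G ∈ Hol, G 0 = 0 → (∀ z ∈ disc, deriv G z = h z * deriv u z) →
      ∀ ρ ∈ Ioo (0 : ℝ) 1,
        circlePow (p / 2) ρ G ≤ C * (circlePow p ρ h + circlePow p ρ u) := by
  obtain ⟨C, hC, hmain⟩ := exists_integral_rpow_le_of_pos (r := p / 4) (by positivity)
  refine ⟨C * 3 ^ (p / 2), by positivity, fun h hh u hu G hG hG0 hGd ρ hρ => ?_⟩
  have hstep : ∀ δ > 0, circlePow (p / 2) ρ G ≤
      C * (3 ^ (p / 2) * (circlePow p ρ h + circlePow p ρ u + 2 * Real.pi * δ)) := by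
    intro δ hδ
    -- The regularising constant is chosen so that its power p/2 = 2r is δ, which is sent to 0 at
    -- the end.
    have hm := hmain h u G hh hu hG hG0 hGd (δ ^ (p / 2)⁻¹) (by positivity) (Real.log ρ)
      (Real.log_neg hρ.1 hρ.2)
    simp only [exp_log_add_mul_I hρ.1] at hm
    have e1 : ∀ θ : ℝ, Complex.normSq (G (circleMap 0 ρ θ)) ^ (p / 4) =
        ‖G (circleMap 0 ρ θ)‖ ^ (p / 2) := fun θ => by
      rw [normSq_rpow]; congr 1; ring
    simp only [e1] at hm
    refine hm.trans (mul_le_mul_of_nonneg_left ?_ hC)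
    have ch := continuous_norm_rpow_comp_circleMap hh hp hρ
    have cu := continuous_norm_rpow_comp_circleMap hu hp hρ
    have c1 := continuous_comp_circleMap hh hρ
    have c2 := continuous_comp_circleMap hu hρ
    calc _ ≤ ∫ θ in (0 : ℝ)..2 * Real.pi, 3 ^ (p / 2) *
          (‖h (circleMap 0 ρ θ)‖ ^ p + ‖u (circleMap 0 ρ θ)‖ ^ p + δ) := by
          refine intervalIntegral.integral_mono (by positivity) ?_ ?_ fun θ => ?_
          · refine (Continuous.rpow_const ?_ fun _ => Or.inr (by positivity)).intervalIntegrable _ _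
            exact ((Complex.continuous_normSq.comp c1).add
              (Complex.continuous_normSq.comp c2)).add continuous_const
          · exact (continuous_const.mul ((ch.add cu).add continuous_const)).intervalIntegrable _ _
          · have e2 : 2 * (p / 4) = p / 2 := by ring
            have := add_add_rpow_le (Complex.normSq_nonneg (h (circleMap 0 ρ θ)))
              (Complex.normSq_nonneg (u (circleMap 0 ρ θ)))
              (show 0 ≤ δ ^ (p / 2)⁻¹ by positivity) (show 0 ≤ p / 2 by positivity)
            rw [normSq_rpow, normSq_rpow, ← Real.rpow_mul hδ.le, inv_mul_cancel₀ (by positivity),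
              Real.rpow_one, mul_div_cancel₀ p two_ne_zero] at this
            simpa only [e2] using this
      _ = _ := by
          rw [intervalIntegral.integral_const_mul, intervalIntegral.integral_add
            ((ch.intervalIntegrable _ _).add (cu.intervalIntegrable _ _)) intervalIntegrable_const,
            intervalIntegral.integral_add (ch.intervalIntegrable _ _) (cu.intervalIntegrable _ _)]
          simp [circlePow]
  rw [mul_assoc]
  have hlim : Filter.Tendsto (fun δ : ℝ => C * (3 ^ (p / 2) * (circlePow p ρ h + circlePow p ρ u +
      2 * Real.pi * δ))) (nhdsWithin 0 (Ioi 0)) (nhds (C * (3 ^ (p / 2) *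
        (circlePow p ρ h + circlePow p ρ u)))) := by
    refine tendsto_nhdsWithin_of_tendsto_nhds ?_
    have : Continuous fun δ : ℝ => C * (3 ^ (p / 2) * (circlePow p ρ h + circlePow p ρ u +
      2 * Real.pi * δ)) := by fun_prop
    simpa using this.tendsto 0
  refine ge_of_tendsto hlim ?_
  filter_upwards [self_mem_nhdsWithin] with δ hδ using hstep δ hδ

theorem circlePow_const_mul {c : ℂ} (p ρ : ℝ) (f : ℂ → ℂ) :
    circlePow p ρ (fun z => c * f z) = ‖c‖ ^ p * circlePow p ρ f := by
  simp only [circlePow, norm_mul, Real.mul_rpow (norm_nonneg _) (norm_nonneg _)]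
  rw [intervalIntegral.integral_const_mul]

/-- The additive estimate is applied to G = F²/2. Its left side is unchanged under h → λh, u → u/λ,
so the right side can be optimised over λ. -/
theorem exists_circlePow_sq_le {p : ℝ} (hp : 0 < p) : ∃ C : ℝ, 0 < C ∧
    ∀ h ∈ Hol, ∀ u ∈ Hol, ∀ F ∈ Hol, F 0 = 0 → (∀ z ∈ disc, F z * deriv F z = h z * deriv u z) →
      ∀ ρ ∈ Ioo (0 : ℝ) 1, circlePow p ρ F ^ 2 ≤ C * circlePow p ρ h * circlePow p ρ u := by
  obtain ⟨C, hC, hmain⟩ := exists_circlePow_le_add hp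
  refine ⟨4 * (2 ^ (p / 2) * C) ^ 2 + 1, by positivity, fun h hh u hu F hF hF0 hFd ρ hρ => ?_⟩
  have hX := circlePow_nonneg p ρ h
  have hY := circlePow_nonneg p ρ u
  have hM := circlePow_nonneg p ρ F
  have hG : (fun z => 2⁻¹ * (F z * F z)) ∈ Hol :=
    (differentiableOn_const _).mul (DifferentiableOn.mul hF hF)
  have hGF : circlePow (p / 2) ρ (fun z => 2⁻¹ * (F z * F z)) =
      2⁻¹ ^ (p / 2) * circlePow p ρ F := by
    rw [circlePow_const_mul]
    congr 1
    · norm_num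
    · refine intervalIntegral.integral_congr fun θ _ => ?_
      simp only [norm_mul]
      rw [← sq, ← Real.rpow_natCast, ← Real.rpow_mul (norm_nonneg _)]
      congr 1; push_cast; ring
  have hμ : ∀ μ : ℝ, 0 < μ → circlePow p ρ F ≤
      2 ^ (p / 2) * C * (μ * circlePow p ρ h + μ⁻¹ * circlePow p ρ u) := by
    intro μ hμ
    -- With λ^p = μ the means of h and u are multiplied by μ and 1/μ.
    set l : ℝ := μ ^ p⁻¹ with hl
    have hl0 : 0 < l := by positivity
    have hlp : l ^ p = μ := by rw [hl, ← Real.rpow_mul hμ.le, inv_mul_cancel₀ hp.ne', Real.rpow_one]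
    have hd : ∀ f ∈ Hol, ∀ z ∈ disc, DifferentiableAt ℂ f z := fun f hf z hz =>
      (hf z hz).differentiableAt (isOpen_disc.mem_nhds hz)
    have := hmain (fun z => l * h z) ((differentiableOn_const _).mul hh)
      (fun z => (l : ℂ)⁻¹ * u z) ((differentiableOn_const _).mul hu) _ hG (by simp [hF0])
      (fun z hz => by
        have e1 : HasDerivAt (fun z => 2⁻¹ * (F z * F z))
            (2⁻¹ * (deriv F z * F z + F z * deriv F z)) z :=
          ((hd F hF z hz).hasDerivAt.mul (hd F hF z hz).hasDerivAt).const_mul _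
        have e2 : HasDerivAt (fun z => (l : ℂ)⁻¹ * u z) ((l : ℂ)⁻¹ * deriv u z) z :=
          (hd u hu z hz).hasDerivAt.const_mul _
        have hl' : (l : ℂ) ≠ 0 := by exact_mod_cast hl0.ne'
        rw [e1.deriv, e2.deriv, mul_comm (deriv F z), hFd z hz]
        field_simp
        ring) ρ hρ
    rw [hGF, circlePow_const_mul, circlePow_const_mul, norm_inv, Complex.norm_real,
      Real.norm_of_nonneg hl0.le, Real.inv_rpow hl0.le, hlp, Real.inv_rpow zero_le_two,
      inv_mul_le_iff₀ (by positivity)] at this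
    linarith
  set E := 2 ^ (p / 2) * C
  have hE : 0 ≤ E := by positivity
  -- Multiplied by μ, the bound says that a quadratic in μ is nonnegative (trivially so for μ ≤ 0).
  -- Its discriminant gives the product estimate without dividing by means that may vanish.
  have hdisc := discrim_le_zero (a := E * circlePow p ρ h) (b := -circlePow p ρ F)
    (c := E * circlePow p ρ u) fun μ => by
      rcases le_or_gt μ 0 with h0 | h0
      · have := mul_nonneg hM (neg_nonneg.2 h0)
        have := mul_nonneg (mul_nonneg hE hX) (mul_self_nonneg μ)
        have := mul_nonneg hE hY
        linarith
      · have h1 := mul_le_mul_of_nonneg_right (hμ μ h0) h0.le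
        have h2 : E * (μ * circlePow p ρ h + μ⁻¹ * circlePow p ρ u) * μ =
            E * circlePow p ρ h * (μ * μ) + E * circlePow p ρ u := by
          field_simp
        linarith
  rw [discrim] at hdisc
  have := mul_nonneg hX hY
  linarith

/-! ### Iterating log-convexity, and the operator T -/

theorem exists_pow_le_of_sq_le {C : ℝ} (hC : 0 < C) {n : ℕ} (hn : 1 ≤ n) : ∃ c : ℝ, 0 < c ∧
    ∀ M : ℕ → ℝ, (∀ k, 0 ≤ M k) → (∀ k, M (k + 1) ^ 2 ≤ C * M k * M (k + 2)) →
      M 1 ^ n ≤ c * M n * M 0 ^ (n - 1) := by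
  induction n, hn using Nat.le_induction with
  | base => exact ⟨1, one_pos, fun M _ _ => by simp⟩
  | succ n hn ih =>
    obtain ⟨c, hc, ih⟩ := ih
    refine ⟨c * C ^ n, by positivity, fun M h0 h2 => ?_⟩
    rcases (h0 1).eq_or_lt with h1 | h1
    · rw [← h1, zero_pow (by omega)]
      have := h0 0
      have := h0 (n + 1)
      positivity
    -- A later zero would propagate back to M 1; positivity permits the cancellation in `hratio`.
    have hpos : ∀ k, 0 < M (k + 1) := by
      intro k
      induction k with
      | zero => exact h1
      | succ k ihk =>
        refine (h0 _).lt_of_ne' fun h => ?_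
        have := h2 k
        rw [show k + 2 = k + 1 + 1 from rfl, h, mul_zero] at this
        exact absurd this (not_le.2 (by positivity))
    -- The first ratio M 1 / M 0 is at most C^k times the k-th one, written without division.
    have hratio : ∀ k, M 1 * M k ≤ C ^ k * M (k + 1) * M 0 := by
      intro k
      induction k with
      | zero => simp
      | succ k ihk =>
        refine le_of_mul_le_mul_right ?_ (hpos k)
        calc M 1 * M (k + 1) * M (k + 1) = M 1 * M (k + 1) ^ 2 := by ring
          _ ≤ M 1 * (C * M k * M (k + 2)) := by gcongr; exact h2 k
          _ = C * (M 1 * M k) * M (k + 2) := by ring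
          _ ≤ C * (C ^ k * M (k + 1) * M 0) * M (k + 2) := by
              have := h0 (k + 2)
              gcongr
          _ = _ := by ring
    have hn' : M 0 ^ n = M 0 ^ (n - 1) * M 0 := by
      rw [← pow_succ, Nat.sub_add_cancel hn]
    calc M 1 ^ (n + 1) = M 1 ^ n * M 1 := pow_succ _ _
      _ ≤ c * M n * M 0 ^ (n - 1) * M 1 := by gcongr; exact ih M h0 h2
      _ = c * M 0 ^ (n - 1) * (M 1 * M n) := by ring
      _ ≤ c * M 0 ^ (n - 1) * (C ^ n * M (n + 1) * M 0) := by
          have := h0 0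
          exact mul_le_mul_of_nonneg_left (hratio n) (by positivity)
      _ = _ := by rw [Nat.add_sub_cancel, hn']; ring

/-- An analytic integrand on a disc has a primitive, which the segment integral recovers up to its
value at 0. -/
theorem exists_T_eq_sub {f g : ℂ → ℂ} (hf : f ∈ Hol) (hg : g ∈ Hol) : ∃ Φ : ℂ → ℂ,
    (∀ z ∈ disc, HasDerivAt Φ (f z * deriv g z) z) ∧ ∀ z ∈ disc, T g f z = Φ z - Φ 0 := by
  have hφ : DifferentiableOn ℂ (fun z => f z * deriv g z) disc :=
    DifferentiableOn.mul hf (DifferentiableOn.deriv hg isOpen_disc)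
  obtain ⟨Φ, hΦ⟩ := DifferentiableOn.isExactOn_ball hφ
  refine ⟨Φ, hΦ, fun z hz => ?_⟩
  have hmem : ∀ t ∈ uIcc (0 : ℝ) 1, (t : ℂ) * z ∈ disc := by
    intro t ht
    rw [uIcc_of_le zero_le_one] at ht
    simp only [disc, mem_ball_zero_iff, norm_mul, Complex.norm_real, Real.norm_of_nonneg ht.1] at hz ⊢
    nlinarith [ht.2, norm_nonneg z]
  have hd : ∀ t ∈ uIcc (0 : ℝ) 1, HasDerivAt (fun t : ℝ => Φ (t * z))
      (f (t * z) * deriv g (t * z) * z) t := fun t ht => by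
    have h1 : HasDerivAt (fun t : ℝ => (t : ℂ) * z) z t := by
      simpa using (Complex.ofRealCLM.hasDerivAt (x := t)).mul_const z
    exact (hΦ _ (hmem t ht)).comp t h1
  have hcont : ContinuousOn (fun t : ℝ => f (t * z) * deriv g (t * z) * z) (uIcc 0 1) :=
    (hφ.continuousOn.comp (f := fun t : ℝ => (t : ℂ) * z) (by fun_prop) hmem).mul continuousOn_const
  rw [T, intervalIntegral.integral_eq_sub_of_hasDerivAt hd hcont.intervalIntegrable]
  simp

theorem hasDerivAt_T {f g : ℂ → ℂ} (hf : f ∈ Hol) (hg : g ∈ Hol) {z : ℂ} (hz : z ∈ disc) :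
    HasDerivAt (T g f) (f z * deriv g z) z := by
  obtain ⟨Φ, h1, h2⟩ := exists_T_eq_sub hf hg
  refine ((h1 z hz).sub_const (Φ 0)).congr_of_eventuallyEq ?_
  filter_upwards [isOpen_disc.mem_nhds hz] with w hw using h2 w hw

theorem T_mem_Hol {f g : ℂ → ℂ} (hf : f ∈ Hol) (hg : g ∈ Hol) : T g f ∈ Hol := fun _ hz =>
  (hasDerivAt_T hf hg hz).differentiableAt.differentiableWithinAt

theorem T_apply_zero (f g : ℂ → ℂ) : T g f 0 = 0 := by simp [T]

theorem iterate_T_mem_Hol {f g : ℂ → ℂ} (hf : f ∈ Hol) (hg : g ∈ Hol) (n : ℕ) :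
    (T g)^[n] f ∈ Hol := by
  induction n with
  | zero => exact hf
  | succ n ih => rw [Function.iterate_succ_apply']; exact T_mem_Hol ih hg

theorem exists_circlePow_T_pow_le {p : ℝ} (hp : 0 < p) {n : ℕ} (hn : 1 ≤ n) : ∃ c : ℝ, 0 < c ∧
    ∀ g ∈ Hol, ∀ f ∈ Hol, ∀ ρ ∈ Ioo (0 : ℝ) 1,
      circlePow p ρ (T g f) ^ n ≤
        c * circlePow p ρ ((T g)^[n] f) * circlePow p ρ f ^ (n - 1) := by
  obtain ⟨C, hC, hsq⟩ := exists_circlePow_sq_le hp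
  obtain ⟨c, hc, hpow⟩ := exists_pow_le_of_sq_le hC hn
  refine ⟨c, hc, fun g hg f hf ρ hρ => ?_⟩
  refine hpow (fun k => circlePow p ρ ((T g)^[k] f)) (fun k => circlePow_nonneg _ _ _) fun k => ?_
  have hk := iterate_T_mem_Hol hf hg k
  simp only [Function.iterate_succ_apply']
  -- Here h, F, u are the iterates k, k+1, k+2; both F F' and h u' equal h F g'.
  refine hsq _ hk _ (T_mem_Hol (T_mem_Hol hk hg) hg) _ (T_mem_Hol hk hg) (T_apply_zero _ _)
    (fun z hz => ?_) ρ hρ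
  rw [(hasDerivAt_T hk hg hz).deriv, (hasDerivAt_T (T_mem_Hol hk hg) hg hz).deriv]
  ring

/-! ### The norms in terms of circle means -/

theorem enorm_rpow_eq_ofReal {p : ℝ} (hp : 0 < p) (z : ℂ) :
    ‖z‖ₑ ^ p = ENNReal.ofReal (‖z‖ ^ p) := by
  rw [← ofReal_norm, ENNReal.ofReal_rpow_of_nonneg (norm_nonneg _) hp.le]

theorem lintegral_Ioc_eq_circlePow {f : ℂ → ℂ} (hf : f ∈ Hol) {p ρ : ℝ} (hp : 0 < p)
    (hρ : ρ ∈ Ioo (0 : ℝ) 1) :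
    ∫⁻ θ in Ioc 0 (2 * Real.pi), ‖f (circleMap 0 ρ θ)‖ₑ ^ p = ENNReal.ofReal (circlePow p ρ f) := by
  have hc := continuous_norm_rpow_comp_circleMap hf hp hρ
  rw [circlePow, intervalIntegral.integral_of_le (by positivity),
    ofReal_integral_eq_lintegral_ofReal (hc.integrableOn_Ioc)
      (Filter.Eventually.of_forall fun θ => Real.rpow_nonneg (norm_nonneg _) _)]
  simp only [enorm_rpow_eq_ofReal hp]

/-- Polar coordinates use angles in (-π, π); periodicity matches them with (0, 2π]. -/
theorem lintegral_Ioo_eq_circlePow {f : ℂ → ℂ} (hf : f ∈ Hol) {p ρ : ℝ} (hp : 0 < p)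
    (hρ : ρ ∈ Ioo (0 : ℝ) 1) :
    ∫⁻ θ in Ioo (-Real.pi) Real.pi, ‖f (circleMap 0 ρ θ)‖ₑ ^ p =
      ENNReal.ofReal (circlePow p ρ f) := by
  have hc := continuous_norm_rpow_comp_circleMap hf hp hρ
  have hper : Function.Periodic (fun θ : ℝ => ‖f (circleMap 0 ρ θ)‖ ^ p) (2 * Real.pi) := fun θ => by
    simp only [periodic_circleMap 0 ρ θ]
  have h := hper.intervalIntegral_add_eq (-Real.pi) 0
  rw [show -Real.pi + 2 * Real.pi = Real.pi by ring, zero_add] at h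
  rw [circlePow, ← h, intervalIntegral.integral_of_le (by linarith [Real.pi_pos]),
    ofReal_integral_eq_lintegral_ofReal (hc.integrableOn_Ioc)
      (Filter.Eventually.of_forall fun θ => Real.rpow_nonneg (norm_nonneg _) _),
    setLIntegral_congr (Ioo_ae_eq_Ioc (μ := volume) (a := -Real.pi) (b := Real.pi))]
  simp only [enorm_rpow_eq_ofReal hp]

theorem eLpNorm_circleMap_eq {f : ℂ → ℂ} (hf : f ∈ Hol) {p ρ : ℝ} (hp : 0 < p)
    (hρ : ρ ∈ Ioo (0 : ℝ) 1) :
    eLpNorm (fun θ : ℝ => f (circleMap 0 ρ θ)) (ENNReal.ofReal p) angleMeasure =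
      ((ENNReal.ofReal (2 * Real.pi))⁻¹ * ENNReal.ofReal (circlePow p ρ f)) ^ (1 / p) := by
  rw [eLpNorm_eq_lintegral_rpow_enorm_toReal (by simpa using hp) ENNReal.ofReal_ne_top,
    ENNReal.toReal_ofReal hp.le, angleMeasure, lintegral_smul_measure,
    lintegral_Ioc_eq_circlePow hf hp hρ, smul_eq_mul]

/-- The density of the radial part of the Bergman measure. -/
noncomputable def radialWeight (α ρ : ℝ) : ℝ≥0∞ :=
  ENNReal.ofReal ρ * ENNReal.ofReal ((α + 1) / Real.pi * (1 - ρ ^ 2) ^ α)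

theorem measurable_radialWeight (α : ℝ) : Measurable (radialWeight α) := by
  unfold radialWeight
  fun_prop

theorem polarCoord_symm_eq_circleMap (x : ℝ × ℝ) :
    Complex.polarCoord.symm x = circleMap 0 x.1 x.2 := by
  rw [Complex.polarCoord_symm_apply, circleMap, zero_add, Complex.exp_mul_I, Complex.ofReal_cos,
    Complex.ofReal_sin]

theorem aemeasurable_polar {f : ℂ → ℂ} (hf : f ∈ Hol) (p : ℝ) :
    AEMeasurable (fun x : ℝ × ℝ => ‖f (circleMap 0 x.1 x.2)‖ₑ ^ p)
      ((volume.restrict (Ioo 0 1)).prod (volume.restrict (Ioo (-Real.pi) Real.pi))) := by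
  rw [Measure.prod_restrict]
  refine AEMeasurable.pow_const ?_ p
  refine AEMeasurable.enorm ?_
  refine ContinuousOn.aemeasurable ?_ (measurableSet_Ioo.prod measurableSet_Ioo)
  refine hf.continuousOn.comp (f := fun x : ℝ × ℝ => circleMap 0 x.1 x.2) ?_ fun x hx =>
    circleMap_mem_disc hx.1 x.2
  unfold circleMap
  fun_prop

/-- Measurability in ρ, required by Hölder's inequality, comes from Tonelli. -/
theorem aemeasurable_circlePow {f : ℂ → ℂ} (hf : f ∈ Hol) {p : ℝ} (hp : 0 < p) (α : ℝ) :
    AEMeasurable (fun ρ => radialWeight α ρ * ENNReal.ofReal (circlePow p ρ f))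
      (volume.restrict (Ioo 0 1)) := by
  refine (measurable_radialWeight α).aemeasurable.mul ?_
  refine (aemeasurable_polar hf p).lintegral_prod_right'.congr ?_
  filter_upwards [ae_restrict_mem measurableSet_Ioo] with ρ hρ
  exact lintegral_Ioo_eq_circlePow hf hp hρ

theorem lintegral_bergmanMeasure {f : ℂ → ℂ} (hf : f ∈ Hol) {p : ℝ} (hp : 0 < p) (α : ℝ) :
    ∫⁻ z, ‖f z‖ₑ ^ p ∂bergmanMeasure α =
      ∫⁻ ρ in Ioo (0 : ℝ) 1, radialWeight α ρ * ENNReal.ofReal (circlePow p ρ f) := by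
  have hsub : Ioo (0 : ℝ) 1 ×ˢ Ioo (-Real.pi) Real.pi ⊆ polarCoord.target := fun x hx =>
    ⟨hx.1.1, hx.2⟩
  rw [bergmanMeasure, lintegral_withDensity_eq_lintegral_mul_non_measurable _ (by fun_prop)
    (Filter.Eventually.of_forall fun _ => ENNReal.ofReal_lt_top),
    ← lintegral_indicator isOpen_disc.measurableSet, ← Complex.lintegral_comp_polarCoord_symm]
  calc _ = ∫⁻ x in Ioo (0 : ℝ) 1 ×ˢ Ioo (-Real.pi) Real.pi,
        radialWeight α x.1 * ‖f (circleMap 0 x.1 x.2)‖ₑ ^ p := by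
        symm
        rw [← lintegral_indicator (measurableSet_Ioo.prod measurableSet_Ioo),
          ← lintegral_indicator polarCoord.open_target.measurableSet]
        refine lintegral_congr fun x => ?_
        by_cases hx : x ∈ polarCoord.target
        · have hx1 : 0 < x.1 := hx.1
          rw [indicator_of_mem hx, polarCoord_symm_eq_circleMap]
          by_cases h1 : x.1 < 1
          · have hmem : x ∈ Ioo (0 : ℝ) 1 ×ˢ Ioo (-Real.pi) Real.pi := ⟨⟨hx1, h1⟩, hx.2⟩
            rw [indicator_of_mem hmem,
              indicator_of_mem (circleMap_mem_disc ⟨hx1, h1⟩ x.2)]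
            simp [radialWeight, mul_assoc]
          · rw [indicator_of_notMem fun h => h1 h.1.2, indicator_of_notMem, smul_zero]
            simpa [disc, abs_of_pos hx1] using h1
        · rw [indicator_of_notMem hx, indicator_of_notMem fun h => hx (hsub h)]
    _ = _ := by
        have hm : AEMeasurable (fun x : ℝ × ℝ =>
            radialWeight α x.1 * ‖f (circleMap 0 x.1 x.2)‖ₑ ^ p)
            ((volume.restrict (Ioo 0 1)).prod (volume.restrict (Ioo (-Real.pi) Real.pi))) :=
          ((measurable_radialWeight α).comp measurable_fst).aemeasurable.mul
            (aemeasurable_polar hf p)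
        rw [Measure.volume_eq_prod, ← Measure.prod_restrict, lintegral_prod _ hm]
        refine setLIntegral_congr_fun measurableSet_Ioo fun ρ hρ => ?_
        dsimp only
        rw [lintegral_const_mul' _ _ (by simp [radialWeight, ENNReal.mul_eq_top]),
          lintegral_Ioo_eq_circlePow hf hp hρ]

theorem bergmanNorm_eq {f : ℂ → ℂ} (hf : f ∈ Hol) {p : ℝ} (hp : 0 < p) (α : ℝ) :
    bergmanNorm α p f =
      (∫⁻ ρ in Ioo (0 : ℝ) 1, radialWeight α ρ * ENNReal.ofReal (circlePow p ρ f)) ^ (1 / p) := by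
  rw [bergmanNorm, eLpNorm_eq_lintegral_rpow_enorm_toReal (by simpa using hp) ENNReal.ofReal_ne_top,
    ENNReal.toReal_ofReal hp.le, lintegral_bergmanMeasure hf hp]

/-! ### From circles to the spaces -/

theorem rpow_pow_le_of_pow_le {x y z C : ℝ≥0∞} {n : ℕ} {q : ℝ} (hq : 0 ≤ q)
    (h : x ^ n ≤ C * y * z ^ (n - 1)) :
    (x ^ q) ^ n ≤ C ^ q * y ^ q * (z ^ q) ^ (n - 1) := by
  have e : ∀ (a : ℝ≥0∞) (m : ℕ), (a ^ q) ^ m = (a ^ m) ^ q := fun a m => by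
    rw [← ENNReal.rpow_natCast, ← ENNReal.rpow_natCast, ← ENNReal.rpow_mul, ← ENNReal.rpow_mul,
      mul_comm]
  rw [e, e, ← ENNReal.mul_rpow_of_nonneg _ _ hq, ← ENNReal.mul_rpow_of_nonneg _ _ hq]
  exact ENNReal.rpow_le_rpow h hq

/-- Both sides have degree n in (x, y, z), so a common weight passes through. -/
theorem mul_pow_le_of_pow_le {x y z C k : ℝ≥0∞} {n : ℕ} (hn : 1 ≤ n)
    (h : x ^ n ≤ C * y * z ^ (n - 1)) :
    (k * x) ^ n ≤ C * (k * y) * (k * z) ^ (n - 1) := by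
  obtain ⟨m, rfl⟩ : ∃ m, n = m + 1 := ⟨n - 1, by omega⟩
  simp only [Nat.add_sub_cancel] at h ⊢
  calc (k * x) ^ (m + 1) = k ^ (m + 1) * x ^ (m + 1) := mul_pow _ _ _
    _ ≤ k ^ (m + 1) * (C * y * z ^ m) := by gcongr
    _ = _ := by ring

theorem le_rpow_mul_rpow_of_pow_le {x y z C : ℝ≥0∞} {n : ℕ} (hn : 1 ≤ n)
    (h : x ^ n ≤ C * y * z ^ (n - 1)) :
    x ≤ C ^ (n : ℝ)⁻¹ * (y ^ (n : ℝ)⁻¹ * z ^ (1 - (n : ℝ)⁻¹)) := by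
  have hn0 : (0 : ℝ) < n := by exact_mod_cast hn
  have h1 := (ENNReal.le_rpow_inv_iff hn0).2 ((ENNReal.rpow_natCast x n).trans_le h)
  rw [ENNReal.mul_rpow_of_nonneg _ _ (by positivity), ENNReal.mul_rpow_of_nonneg _ _ (by positivity),
    ← ENNReal.rpow_natCast, ← ENNReal.rpow_mul, mul_assoc, Nat.cast_sub hn, sub_mul,
    mul_inv_cancel₀ hn0.ne', Nat.cast_one, one_mul] at h1
  exact h1

/-- Hölder's inequality with weights 1/n and 1 - 1/n, after taking n-th roots pointwise. -/
theorem lintegral_pow_le_of_pow_le {X : Type*} [MeasurableSpace X] {μ : Measure X}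
    {x y z : X → ℝ≥0∞} (hy : AEMeasurable y μ) (hz : AEMeasurable z μ) {C : ℝ≥0∞} (hC : C ≠ ∞)
    {n : ℕ} (hn : 1 ≤ n) (h : ∀ᵐ a ∂μ, x a ^ n ≤ C * y a * z a ^ (n - 1)) :
    (∫⁻ a, x a ∂μ) ^ n ≤ C * (∫⁻ a, y a ∂μ) * (∫⁻ a, z a ∂μ) ^ (n - 1) := by
  have hn0 : (0 : ℝ) < n := by exact_mod_cast hn
  have hn1 : (n : ℝ)⁻¹ ≤ 1 := inv_le_one_of_one_le₀ (by exact_mod_cast hn)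
  have h1 : ∫⁻ a, x a ∂μ ≤ C ^ (n : ℝ)⁻¹ *
      ((∫⁻ a, y a ∂μ) ^ (n : ℝ)⁻¹ * (∫⁻ a, z a ∂μ) ^ (1 - (n : ℝ)⁻¹)) := by
    calc _ ≤ ∫⁻ a, C ^ (n : ℝ)⁻¹ * (y a ^ (n : ℝ)⁻¹ * z a ^ (1 - (n : ℝ)⁻¹)) ∂μ :=
          lintegral_mono_ae (h.mono fun a ha => le_rpow_mul_rpow_of_pow_le hn ha)
      _ = C ^ (n : ℝ)⁻¹ * ∫⁻ a, y a ^ (n : ℝ)⁻¹ * z a ^ (1 - (n : ℝ)⁻¹) ∂μ :=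
          lintegral_const_mul' _ _ (ENNReal.rpow_ne_top_of_nonneg (by positivity) hC)
      _ ≤ _ := by
          gcongr
          exact ENNReal.lintegral_mul_norm_pow_le hy hz (by positivity) (by linarith) (by ring)
  calc _ ≤ (C ^ (n : ℝ)⁻¹ *
        ((∫⁻ a, y a ∂μ) ^ (n : ℝ)⁻¹ * (∫⁻ a, z a ∂μ) ^ (1 - (n : ℝ)⁻¹))) ^ n := by gcongr
    _ = _ := by
        rw [mul_pow, mul_pow]
        simp only [← ENNReal.rpow_natCast, ← ENNReal.rpow_mul]
        rw [inv_mul_cancel₀ hn0.ne', ENNReal.rpow_one, ENNReal.rpow_one, sub_mul,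
          inv_mul_cancel₀ hn0.ne', one_mul, Nat.cast_sub hn, Nat.cast_one, mul_assoc]

theorem spaceNorm_pow_le_of_circlePow_pow_le {p : ℝ} (hp : 0 < p) (α : ℝ) {n : ℕ} (hn : 1 ≤ n)
    {c : ℝ} (hc : 0 < c) {F G H : ℂ → ℂ} (hF : F ∈ Hol) (hG : G ∈ Hol) (hH : H ∈ Hol)
    (h : ∀ ρ ∈ Ioo (0 : ℝ) 1,
      circlePow p ρ F ^ n ≤ c * circlePow p ρ G * circlePow p ρ H ^ (n - 1)) :
    spaceNorm α p F ^ n ≤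
      ENNReal.ofReal c ^ (1 / p) * spaceNorm α p G * spaceNorm α p H ^ (n - 1) := by
  have hn0 : (0 : ℝ) < n := by exact_mod_cast hn
  have h' : ∀ ρ ∈ Ioo (0 : ℝ) 1, ENNReal.ofReal (circlePow p ρ F) ^ n ≤
      ENNReal.ofReal c * ENNReal.ofReal (circlePow p ρ G) *
        ENNReal.ofReal (circlePow p ρ H) ^ (n - 1) := fun ρ hρ => by
    have hG0 := circlePow_nonneg p ρ G
    rw [← ENNReal.ofReal_pow (circlePow_nonneg _ _ _), ← ENNReal.ofReal_pow (circlePow_nonneg _ _ _),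
      ← ENNReal.ofReal_mul hc.le, ← ENNReal.ofReal_mul (by positivity)]
    exact ENNReal.ofReal_le_ofReal (h ρ hρ)
  unfold spaceNorm
  split_ifs with hα
  -- The power n is moved to the right so that the supremum over radii can be bounded one radius at
  -- a time.
  · rw [← ENNReal.rpow_natCast, ← ENNReal.le_rpow_inv_iff hn0]
    refine iSup₂_le fun ρ hρ => ?_
    rw [ENNReal.le_rpow_inv_iff hn0, ENNReal.rpow_natCast]
    have hG' := le_iSup₂ (f := fun (r : ℝ) (_ : r ∈ Ioo (0 : ℝ) 1) =>
      eLpNorm (fun θ : ℝ => G (circleMap 0 r θ)) (ENNReal.ofReal p) angleMeasure) ρ hρ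
    have hH' := le_iSup₂ (f := fun (r : ℝ) (_ : r ∈ Ioo (0 : ℝ) 1) =>
      eLpNorm (fun θ : ℝ => H (circleMap 0 r θ)) (ENNReal.ofReal p) angleMeasure) ρ hρ
    calc _ ≤ ENNReal.ofReal c ^ (1 / p) *
          eLpNorm (fun θ : ℝ => G (circleMap 0 ρ θ)) (ENNReal.ofReal p) angleMeasure *
          eLpNorm (fun θ : ℝ => H (circleMap 0 ρ θ)) (ENNReal.ofReal p) angleMeasure ^ (n - 1) := by
          rw [eLpNorm_circleMap_eq hF hp hρ, eLpNorm_circleMap_eq hG hp hρ,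
            eLpNorm_circleMap_eq hH hp hρ]
          exact rpow_pow_le_of_pow_le (by positivity) (mul_pow_le_of_pow_le hn (h' ρ hρ))
      _ ≤ _ := by
          unfold hardyNorm
          gcongr
  · rw [bergmanNorm_eq hF hp, bergmanNorm_eq hG hp, bergmanNorm_eq hH hp]
    refine rpow_pow_le_of_pow_le (by positivity) ?_
    refine lintegral_pow_le_of_pow_le (aemeasurable_circlePow hG hp α)
      (aemeasurable_circlePow hH hp α) ENNReal.ofReal_ne_top hn ?_
    filter_upwards [ae_restrict_mem measurableSet_Ioo] with ρ hρ
    exact mul_pow_le_of_pow_le hn (h' ρ hρ)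

/-! ### Boundedness and operator norms -/

theorem exists_spaceNorm_T_pow_le {p : ℝ} (hp : 0 < p) (α : ℝ) {n : ℕ} (hn : 1 ≤ n) :
    ∃ c : ℝ≥0, 0 < c ∧ ∀ g ∈ Hol, ∀ f ∈ Hol,
      spaceNorm α p (T g f) ^ n ≤
        c * spaceNorm α p ((T g)^[n] f) * spaceNorm α p f ^ (n - 1) := by
  obtain ⟨c, hc, h⟩ := exists_circlePow_T_pow_le hp hn
  refine ⟨c.toNNReal ^ (1 / p), NNReal.rpow_pos (Real.toNNReal_pos.2 hc), fun g hg f hf => ?_⟩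
  have := spaceNorm_pow_le_of_circlePow_pow_le hp α hn hc (T_mem_Hol hf hg)
    (iterate_T_mem_Hol hf hg n) hf (h g hg f hf)
  rwa [ENNReal.coe_rpow_of_nonneg _ (by positivity)]

/-- Inserting ‖T_g^n f‖ ≤ C‖f‖ and taking n-th roots gives the constant (cC)^(1/n), and with it
finiteness of ‖T_g f‖. -/
theorem isBounded_T_of_pow_le {p α : ℝ} {n : ℕ} (hn : 1 ≤ n) {c : ℝ≥0} {g : ℂ → ℂ} (hg : g ∈ Hol)
    (h : ∀ f ∈ Hol, spaceNorm α p (T g f) ^ n ≤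
      c * spaceNorm α p ((T g)^[n] f) * spaceNorm α p f ^ (n - 1))
    (hb : IsBounded α p (T g)^[n]) : IsBounded α p (T g) := by
  have hn0 : (0 : ℝ) < n := by exact_mod_cast hn
  obtain ⟨C, hC⟩ := hb
  have key : ∀ f ∈ bergmanSpace α p,
      spaceNorm α p (T g f) ≤ ((c * C) ^ (n : ℝ)⁻¹ : ℝ≥0) * spaceNorm α p f := by
    intro f hf
    have h1 : spaceNorm α p (T g f) ^ n ≤ (c * C : ℝ≥0) * spaceNorm α p f ^ n := by
      refine (h f hf.1).trans ?_
      calc _ ≤ (c : ℝ≥0∞) * (C * spaceNorm α p f) * spaceNorm α p f ^ (n - 1) := by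
            gcongr
            exact (hC f hf).2
        _ = _ := by
            obtain ⟨m, rfl⟩ : ∃ m, n = m + 1 := ⟨n - 1, by omega⟩
            rw [Nat.add_sub_cancel]
            push_cast
            ring
    rw [← ENNReal.rpow_natCast, ← ENNReal.le_rpow_inv_iff hn0,
      ENNReal.mul_rpow_of_nonneg _ _ (by positivity), ← ENNReal.rpow_natCast, ← ENNReal.rpow_mul,
      mul_inv_cancel₀ hn0.ne', ENNReal.rpow_one] at h1
    rwa [ENNReal.coe_rpow_of_nonneg _ (by positivity)]
  exact ⟨_, fun f hf => ⟨⟨T_mem_Hol hf.1 hg,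
    (key f hf).trans_lt (ENNReal.mul_lt_top ENNReal.coe_lt_top hf.2)⟩, key f hf⟩⟩

theorem operatorNorm_T_pow_le {p α : ℝ} {n : ℕ} (hn : 1 ≤ n) {c : ℝ≥0} {g : ℂ → ℂ}
    (h : ∀ f ∈ Hol, spaceNorm α p (T g f) ^ n ≤
      c * spaceNorm α p ((T g)^[n] f) * spaceNorm α p f ^ (n - 1)) :
    operatorNorm α p (T g) ^ n ≤ c * operatorNorm α p (T g)^[n] := by
  have hn0 : (0 : ℝ) < n := by exact_mod_cast hn
  rw [← ENNReal.rpow_natCast, ← ENNReal.le_rpow_inv_iff hn0]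
  refine iSup₂_le fun f hf => ?_
  rw [ENNReal.le_rpow_inv_iff hn0, ENNReal.rpow_natCast]
  calc _ ≤ c * spaceNorm α p ((T g)^[n] f) * spaceNorm α p f ^ (n - 1) := h f hf.1.1
    _ ≤ c * spaceNorm α p ((T g)^[n] f) * 1 := by
        gcongr
        exact pow_le_one₀ zero_le hf.2
    _ ≤ _ := by
        rw [mul_one]
        gcongr
        exact le_iSup₂ (f := fun (f : ℂ → ℂ)
          (_ : f ∈ {f | f ∈ bergmanSpace α p ∧ spaceNorm α p f ≤ 1}) =>
            spaceNorm α p ((T g)^[n] f)) f hf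

theorem IsBounded.iterate {p α : ℝ} {L : (ℂ → ℂ) → (ℂ → ℂ)} (h : IsBounded α p L) (n : ℕ) :
    IsBounded α p L^[n] := by
  obtain ⟨C, hC⟩ := h
  induction n with
  | zero => exact ⟨1, fun f hf => ⟨hf, by simp⟩⟩
  | succ n ih =>
    obtain ⟨D, hD⟩ := ih
    refine ⟨C * D, fun f hf => ?_⟩
    obtain ⟨h1, h2⟩ := hD f hf
    obtain ⟨h3, h4⟩ := hC _ h1
    rw [Function.iterate_succ_apply']
    refine ⟨h3, h4.trans ?_⟩
    push_cast
    rw [mul_assoc]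
    gcongr

end AnalyticParaproduct

theorem mainTheorem5 (p α : ℝ) (hp : 0 < p) (hα : -1 ≤ α) :
    (∀ n : ℕ, 1 < n → ∃ c : ℝ≥0, 0 < c ∧
      ∀ g ∈ AnalyticParaproduct.Hol,
        AnalyticParaproduct.IsBounded α p (AnalyticParaproduct.T g)^[n] →
          AnalyticParaproduct.IsBounded α p (AnalyticParaproduct.T g) ∧
          (∀ f ∈ AnalyticParaproduct.bergmanSpace α p,
            AnalyticParaproduct.spaceNorm α p (AnalyticParaproduct.T g f) ^ n ≤
              c * AnalyticParaproduct.spaceNorm α p ((AnalyticParaproduct.T g)^[n] f) *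
                AnalyticParaproduct.spaceNorm α p f ^ (n - 1)) ∧
          AnalyticParaproduct.operatorNorm α p (AnalyticParaproduct.T g) ^ n ≤
            c * AnalyticParaproduct.operatorNorm α p (AnalyticParaproduct.T g)^[n]) ∧
    (∀ g ∈ AnalyticParaproduct.Hol,
      ((∃ n : ℕ, 1 ≤ n ∧ AnalyticParaproduct.IsBounded α p (AnalyticParaproduct.T g)^[n]) ↔
        ∀ n : ℕ, 1 ≤ n → AnalyticParaproduct.IsBounded α p (AnalyticParaproduct.T g)^[n])) := by
  refine ⟨fun n hn => ?_, fun g hg => ⟨?_, fun h => ⟨1, le_rfl, h 1 le_rfl⟩⟩⟩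
  · obtain ⟨c, hc, h⟩ := AnalyticParaproduct.exists_spaceNorm_T_pow_le hp α hn.le
    exact ⟨c, hc, fun g hg hb =>
      ⟨AnalyticParaproduct.isBounded_T_of_pow_le hn.le hg (h g hg) hb,
        fun f hf => h g hg f hf.1, AnalyticParaproduct.operatorNorm_T_pow_le hn.le (h g hg)⟩⟩
  · rintro ⟨n, hn, hb⟩ m -
    obtain ⟨c, -, h⟩ := AnalyticParaproduct.exists_spaceNorm_T_pow_le hp α hn
    exact (AnalyticParaproduct.isBounded_T_of_pow_le hn hg (h g hg) hb).iterate m
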